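/- Let $K$ be a field of characteristic $0$ that contains an element of multiplicative order $9$, and let $$\mathrm{M}_{27}=\mathrm{C}_9\rtimes \mathrm{C}_3=\langle a,b\mid a^9=b^3=1,\ bab^{-1}=a^4\rangle$$ be the non-abelian group of order $27$ with a cyclic subgroup of index $3$. Then $$\beta_{\mathrm{sep}}^K(\mathrm{M}_{27})=10,\qquad\text{while}\qquad \beta^K(\mathrm{M}_{27})=11.$$ Here, for a finite group $G$ and a finite dimensional $KG$-module $V$, $K[V]^G$ denotes the algebra of $G$-invariant polynomials on $V$; $\beta(G,V)$ is the minimal positive integer $d$ such that the $K$-algebra $K[V]^G$ is generated by elements of degree at most $d$; $\beta_{\mathrm{sep}}(G,V)$ is the minimal positive integer $d$ such that for all $v,w\in V$ with $G\cdot v\ne G\cdot w$ there is an $f\in K[V]^G$ of degree at most $d$ with $f(v)\neq f(w)$. The Noether number $\beta^K(G)$ and the separating Noether number $\beta_{\mathrm{sep}}^K(G)$ are the suprema of $\beta(G,V)$ and of $\beta_{\mathrm{sep}}(G,V)$, respectively, as $V$ ranges over all finite dimensional $KG$-modules. -/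

import Mathlib

open scoped Matrix

/-! ### Polynomial invariants of a matrix representation

A finite dimensional `KG`-module is given, after a choice of a basis, by a group homomorphism
`ψ : G →* GL (Fin n) K`; the underlying space is `V = Kⁿ` (column vectors, `g • v = ψ(g) v`),
and its coordinate ring `K[V]` is `MvPolynomial (Fin n) K`. -/

/-- The `K`-algebra endomorphism `f ↦ g • f` of `K[V] = K[x₁, …, xₙ]`, determined by
`g • x_j = ∑ i, ψ(g⁻¹)_{j i} x_i`, i.e. `(g • f)(v) = f(g⁻¹ • v)`. -/
noncomputable def polyAct {K G : Type*} [Field K] [Group G] {n : ℕ}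
    (ψ : G →* GL (Fin n) K) (g : G) :
    MvPolynomial (Fin n) K →ₐ[K] MvPolynomial (Fin n) K :=
  MvPolynomial.aeval fun j =>
    ∑ i, MvPolynomial.C ((ψ g⁻¹ : Matrix (Fin n) (Fin n) K) j i) * MvPolynomial.X i

theorem eval_polyAct {K G : Type*} [Field K] [Group G] {n : ℕ}
    (ψ : G →* GL (Fin n) K) (g : G) (f : MvPolynomial (Fin n) K) (v : Fin n → K) :
    MvPolynomial.eval v (polyAct ψ g f) =
      MvPolynomial.eval ((ψ g⁻¹ : Matrix (Fin n) (Fin n) K) *ᵥ v) f := by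
  induction f using MvPolynomial.induction_on with
  | C a => simp [polyAct]
  | add p q hp hq => simp [hp, hq]
  | mul_X p j hp =>
    rw [map_mul, map_mul, map_mul, hp]
    simp [polyAct, Matrix.mulVec, dotProduct]

/-- The algebra `K[V]^G` of polynomial invariants. -/
noncomputable def polyInvariants {K G : Type*} [Field K] [Group G] {n : ℕ}
    (ψ : G →* GL (Fin n) K) : Subalgebra K (MvPolynomial (Fin n) K) where
  carrier := {f | ∀ g : G, polyAct ψ g f = f}
  mul_mem' := fun {p q} hp hq g => by rw [map_mul, hp g, hq g]
  add_mem' := fun {p q} hp hq g => by rw [map_add, hp g, hq g]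
  algebraMap_mem' := fun r g => (polyAct ψ g).commutes r

/-- The orbit `G • v` of a vector `v`. -/
def vecOrbit {K G : Type*} [Field K] [Group G] {n : ℕ}
    (ψ : G →* GL (Fin n) K) (v : Fin n → K) : Set (Fin n → K) :=
  Set.range fun g : G => (ψ g : Matrix (Fin n) (Fin n) K) *ᵥ v

/-- The set of invariants of (total) degree at most `d`. -/
def invariantsOfDegreeLE {K G : Type*} [Field K] [Group G] {n : ℕ}
    (ψ : G →* GL (Fin n) K) (d : ℕ) : Set (MvPolynomial (Fin n) K) :=
  {f | f ∈ polyInvariants ψ ∧ f.totalDegree ≤ d}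

/-- A set `S` of polynomials (to be applied to sets of invariants) is separating if any two
vectors with distinct orbits are distinguished by some element of `S`. -/
def IsSeparatingSet {K G : Type*} [Field K] [Group G] {n : ℕ}
    (ψ : G →* GL (Fin n) K) (S : Set (MvPolynomial (Fin n) K)) : Prop :=
  ∀ v w : Fin n → K, vecOrbit ψ v ≠ vecOrbit ψ w →
    ∃ f ∈ S, MvPolynomial.eval v f ≠ MvPolynomial.eval w f

/-- `β(G, V)`: the minimal positive integer `d` such that the algebra `K[V]^G` is generated by
its elements of degree at most `d` (and `⊤` if there were no such `d`). -/
noncomputable def noetherNumberRep {K G : Type*} [Field K] [Group G] {n : ℕ}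
    (ψ : G →* GL (Fin n) K) : ℕ∞ :=
  ⨅ (d : ℕ) (_ : 0 < d ∧ Algebra.adjoin K (invariantsOfDegreeLE ψ d) = polyInvariants ψ), (d : ℕ∞)

/-- `β_sep(G, V)`: the minimal positive integer `d` such that the invariants of degree at most `d`
form a separating set (and `⊤` if there were no such `d`). -/
noncomputable def sepNoetherNumberRep {K G : Type*} [Field K] [Group G] {n : ℕ}
    (ψ : G →* GL (Fin n) K) : ℕ∞ :=
  ⨅ (d : ℕ) (_ : 0 < d ∧ IsSeparatingSet ψ (invariantsOfDegreeLE ψ d)), (d : ℕ∞)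

/-- The Noether number `β^K(G)`: the supremum of `β(G, V)` over all finite dimensional
`KG`-modules `V`. -/
noncomputable def noetherNumber (K G : Type*) [Field K] [Group G] : ℕ∞ :=
  ⨆ (n : ℕ) (ψ : G →* GL (Fin n) K), noetherNumberRep ψ

/-- The separating Noether number `β_sep^K(G)`: the supremum of `β_sep(G, V)` over all finite
dimensional `KG`-modules `V`. -/
noncomputable def sepNoetherNumber (K G : Type*) [Field K] [Group G] : ℕ∞ :=
  ⨆ (n : ℕ) (ψ : G →* GL (Fin n) K), sepNoetherNumberRep ψ

/-! ### The group `M₂₇ = C₉ ⋊ C₃` -/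

/-- The action of `C₃` on `C₉` in which the element `j` of `C₃ = ℤ/3` acts as multiplication by
`4 ^ j` on `C₉ = ℤ/9`. -/
def m27Action : Multiplicative (ZMod 3) →* MulAut (Multiplicative (ZMod 9)) where
  toFun j :=
    { toFun := fun x => .ofAdd (4 ^ j.toAdd.val * x.toAdd)
      invFun := fun x => .ofAdd (7 ^ j.toAdd.val * x.toAdd)
      left_inv := by revert j; decide
      right_inv := by revert j; decide
      map_mul' := fun x y => by simp [mul_add] }
  map_one' := by ext x; simp
  map_mul' := by
    intro i j
    have h : ∀ i j : ZMod 3, (4 : ZMod 9) ^ (i + j).val = 4 ^ i.val * 4 ^ j.val := by decide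
    ext x
    simp [h, mul_assoc]

/-- The group `M₂₇ = C₉ ⋊ C₃`. -/
abbrev M27 : Type := Multiplicative (ZMod 9) ⋊[m27Action] Multiplicative (ZMod 3)

/-- The generator `a` of order `9`. -/
def M27.a : M27 := SemidirectProduct.inl (.ofAdd 1)

/-- The generator `b` of order `3`. -/
def M27.b : M27 := SemidirectProduct.inr (.ofAdd 1)

theorem M27.relations :
    M27.a ^ 9 = 1 ∧ M27.b ^ 3 = 1 ∧ M27.b * M27.a * M27.b⁻¹ = M27.a ^ 4 := by
  decide

/-- The relators of the presentation `⟨a, b ∣ a⁹ = b³ = 1, b a b⁻¹ = a⁴⟩` (with `a`, `b` the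
free generators indexed by `0`, `1`). -/
def m27Relators : Set (FreeGroup (Fin 2)) :=
  {FreeGroup.of 0 ^ 9, FreeGroup.of 1 ^ 3,
    FreeGroup.of 1 * FreeGroup.of 0 * (FreeGroup.of 1)⁻¹ * (FreeGroup.of 0 ^ 4)⁻¹}

/-- `M₂₇` has the presentation `⟨a, b ∣ a⁹ = b³ = 1, b a b⁻¹ = a⁴⟩`. -/
theorem M27.presentation :
    ∃ e : PresentedGroup m27Relators ≃* M27,
      e (PresentedGroup.of 0) = M27.a ∧ e (PresentedGroup.of 1) = M27.b := by
  let F : Fin 2 → M27 := ![M27.a, M27.b]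
  have hF : ∀ r ∈ m27Relators, FreeGroup.lift F r = 1 := by
    rintro r (rfl | rfl | rfl)
    · simpa [F] using M27.relations.1
    · simpa [F] using M27.relations.2.1
    · simpa [F, mul_inv_eq_one] using M27.relations.2.2
  let φ : PresentedGroup m27Relators →* M27 := PresentedGroup.toGroup hF
  have φa : φ (PresentedGroup.of 0) = M27.a := by simp [φ, F]
  have φb : φ (PresentedGroup.of 1) = M27.b := by simp [φ, F]
  set α : PresentedGroup m27Relators := PresentedGroup.of 0 with hα
  set β : PresentedGroup m27Relators := PresentedGroup.of 1 with hβ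
  have rel : ∀ r ∈ m27Relators, PresentedGroup.mk m27Relators r = 1 := fun r hr =>
    PresentedGroup.one_of_mem hr
  have ra : α ^ 9 = 1 := rel (FreeGroup.of 0 ^ 9) (by simp [m27Relators])
  have rb : β ^ 3 = 1 := rel (FreeGroup.of 1 ^ 3) (by simp [m27Relators])
  have rab : β * α * β⁻¹ = α ^ 4 := by
    have := rel (FreeGroup.of 1 * FreeGroup.of 0 * (FreeGroup.of 1)⁻¹ * (FreeGroup.of 0 ^ 4)⁻¹)
      (by simp [m27Relators])
    rw [← mul_inv_eq_one]
    exact this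
  have comm : ∀ i : ℕ, β * α ^ i = α ^ (4 * i) * β := by
    intro i
    have : (β * α * β⁻¹) ^ i = β * α ^ i * β⁻¹ := conj_pow
    rw [pow_mul, ← rab, this]
    group
  have norm : ∀ x : PresentedGroup m27Relators, ∃ i j : ℕ, x = α ^ i * β ^ j := by
    have ha : ∀ i j : ℕ, α * (α ^ i * β ^ j) = α ^ (i + 1) * β ^ j := fun i j => by
      rw [pow_succ', mul_assoc]
    have hb : ∀ i j : ℕ, β * (α ^ i * β ^ j) = α ^ (4 * i) * β ^ (j + 1) := fun i j => by
      rw [← mul_assoc, comm, pow_succ', mul_assoc]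
    have ia : α⁻¹ = α ^ 8 := by
      rw [inv_eq_iff_mul_eq_one, ← pow_succ', ra]
    have ib : β⁻¹ = β ^ 2 := by
      rw [inv_eq_iff_mul_eq_one, ← pow_succ', rb]
    have closedA : ∀ k : ℕ, ∀ y : PresentedGroup m27Relators, (∃ i j : ℕ, y = α ^ i * β ^ j) →
        ∃ i j : ℕ, α ^ k * y = α ^ i * β ^ j := by
      rintro k y ⟨i, j, rfl⟩
      exact ⟨k + i, j, by rw [pow_add, mul_assoc]⟩
    have closedB : ∀ k : ℕ, ∀ y : PresentedGroup m27Relators, (∃ i j : ℕ, y = α ^ i * β ^ j) →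
        ∃ i j : ℕ, β ^ k * y = α ^ i * β ^ j := by
      intro k
      induction k with
      | zero => intro y hy; simpa using hy
      | succ k ih =>
        rintro y ⟨i, j, rfl⟩
        rw [pow_succ, mul_assoc, hb]
        exact ih _ ⟨_, _, rfl⟩
    intro x
    have key : ∀ x : PresentedGroup m27Relators, x ∈ Subgroup.closure
        (Set.range (PresentedGroup.of : Fin 2 → PresentedGroup m27Relators)) := by
      intro x
      rw [PresentedGroup.closure_range_of]
      trivial
    refine Subgroup.closure_induction_left (p := fun x _ => ∃ i j : ℕ, x = α ^ i * β ^ j)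
      ⟨0, 0, by simp⟩ ?_ ?_ (key x)
    · rintro _ ⟨c, rfl⟩ y _ hy
      fin_cases c
      · simpa using closedA 1 y hy
      · simpa using closedB 1 y hy
    · rintro _ ⟨c, rfl⟩ y _ hy
      fin_cases c
      · have := closedA 8 y hy
        rw [← ia] at this
        exact this
      · have := closedB 2 y hy
        rw [← ib] at this
        exact this
  have inj : Function.Injective φ := by
    rw [injective_iff_map_eq_one]
    intro x hx
    obtain ⟨i, j, rfl⟩ := norm x
    rw [map_mul, map_pow, map_pow, φa, φb] at hx
    have hpow : α ^ i * β ^ j = α ^ (i % 9) * β ^ (j % 3) := by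
      rw [pow_eq_pow_mod i ra, pow_eq_pow_mod j rb]
    rw [pow_eq_pow_mod i M27.relations.1, pow_eq_pow_mod j M27.relations.2.1] at hx
    have small : ∀ i < 9, ∀ j < 3, M27.a ^ i * M27.b ^ j = 1 → i = 0 ∧ j = 0 := by decide
    obtain ⟨hi, hj⟩ := small _ (Nat.mod_lt _ (by norm_num)) _ (Nat.mod_lt _ (by norm_num)) hx
    rw [hpow, hi, hj]
    simp
  have surj : Function.Surjective φ := by
    intro y
    have gen : ∀ x : ZMod 9, ∀ z : ZMod 3,
        M27.a ^ x.val * M27.b ^ z.val = (⟨.ofAdd x, .ofAdd z⟩ : M27) := by decide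
    refine ⟨α ^ y.left.toAdd.val * β ^ y.right.toAdd.val, ?_⟩
    rw [map_mul, map_pow, map_pow, φa, φb, gen]
    rfl
  exact ⟨MulEquiv.ofBijective φ ⟨inj, surj⟩, φa, φb⟩

/-! Notation: `Z = ⟨a³⟩` is central of order 3, and `N = ⟨a³, b⟩ ≅ C₃ × C₃` is abelian of index 3,
with coset representatives `1, a, a²`.

Generation in degree 11. Linear forms are spanned by simultaneous eigenvectors of `N`, with weights
in `(ℤ/3)²`, so every form of degree `d` is a combination of products of `d` eigenvectors. The
transfer of such a product vanishes unless the weights sum to zero. If they do and `d ≥ 12`, the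
sequence of weights breaks into four nonempty zero-sum pieces (`exists_four_zero_sum`), and the
product becomes a product of four `N`-invariants. Benson's argument
(`polyTransfer_mul_mem_of_cover`), with one factor for each of the three cosets of `N` and one to
spare, expresses its transfer through transfers of lower degree.

Lower bounds. Take the sum of the 3-dimensional representation induced from a faithful character of
`⟨a⟩` and a nontrivial character with kernel containing `a`. On the plane spanned by the first and
last basis vectors, with coordinates `x, t`, invariants restrict to combinations of monomials `xⁱtʲ`
with `9 ∣ i`, and with `3 ∣ j` when `i = 0`. Up to degree 9 these cannot tell `t` from `η³t`.
Moreover `x⁹t²` is the restriction of an invariant, but it is not produced by restrictions of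
invariants of degree at most 10.

Separation in degree 10. If `Z` fixes both vectors, an orbit polynomial of degree at most 9
separates them. Otherwise some equivariant map `M` to a faithful 3-dimensional representation does
not kill one of them, say `v`. In that representation `Z` acts by scalars, so invariants have
degrees divisible by 3 and those of degree at most 9 already separate orbits. It remains to treat `M
v = M w = u ≠ 0`. Let `S` be the stabilizer of `u`. A polynomial `f` of degree at most `10 - |S|`
vanishes on the orbit of `u` except at `u` (`exists_vanishing_on_orbit_three`), and an `S`-invariant
`p` of degree at most `|S|` separates `v` from `w`; the transfer of `f(Mx) p(x)` then separates
them. -/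

/-! ### Zero-sum sequences over `(ℤ/3)²`. -/

/-- Chevalley–Warning: a sequence of more than `2 m` elements of `(ℤ/3)^m` has a nonempty
zero-sum subsequence. -/
theorem exists_zero_sum_subset {ι κ : Type*} [Fintype κ] (s : Finset ι) (w : κ → ι → ZMod 3)
    (h : 2 * Fintype.card κ < s.card) :
    ∃ t ⊆ s, t.Nonempty ∧ ∀ k, ∑ i ∈ t, w k i = 0 := by
  have hsq : ∀ y : ZMod 3, y ≠ 0 → y ^ 2 = 1 := by decide
  classical
  have : Fact (Nat.Prime 3) := ⟨Nat.prime_three⟩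
  -- Over `ZMod 3` the square of `x i` is the indicator of `x i ≠ 0`, so the support of a common
  -- zero of these quadrics is a zero-sum subset.
  let f : κ → MvPolynomial s (ZMod 3) := fun k =>
    ∑ i : s, MvPolynomial.C (w k i) * MvPolynomial.X i ^ 2
  have hdeg : ∑ k, (f k).totalDegree < Fintype.card s := by
    have h1 : ∀ k, (f k).totalDegree ≤ 2 := fun k => by
      have : (f k).IsHomogeneous 2 := MvPolynomial.IsHomogeneous.sum _ _ _ fun i _ =>
        MvPolynomial.isHomogeneous_C_mul_X_pow _ _ _
      exact this.totalDegree_le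
    calc ∑ k, (f k).totalDegree ≤ ∑ _k : κ, 2 := Finset.sum_le_sum fun k _ => h1 k
      _ < Fintype.card s := by simpa [mul_comm] using h
  have hdvd := char_dvd_card_solutions_of_fintype_sum_lt 3 hdeg
  have h0 : ∀ k, MvPolynomial.eval (0 : s → ZMod 3) (f k) = 0 := by
    intro k; simp [f]
  -- The number of common zeros is divisible by 3 and positive, since 0 is one of them; hence there
  -- is a nonzero one.
  have hone : 1 < Fintype.card { x : s → ZMod 3 // ∀ k, MvPolynomial.eval x (f k) = 0 } := by
    have : 0 < Fintype.card { x : s → ZMod 3 // ∀ k, MvPolynomial.eval x (f k) = 0 } :=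
      Fintype.card_pos_iff.mpr ⟨⟨0, h0⟩⟩
    have := Nat.le_of_dvd this hdvd
    omega
  have := Fintype.one_lt_card_iff_nontrivial.mp hone
  obtain ⟨⟨x, hx⟩, hne⟩ := exists_ne
    (⟨0, h0⟩ : { x : s → ZMod 3 // ∀ k, MvPolynomial.eval x (f k) = 0 })
  have hx0 : x ≠ 0 := fun h => hne (Subtype.ext h)
  refine ⟨(Finset.univ.filter fun i => x i ≠ 0).map (Function.Embedding.subtype _), ?_, ?_, ?_⟩
  · intro i hi
    simp only [Finset.mem_map, Function.Embedding.coe_subtype] at hi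
    obtain ⟨j, -, rfl⟩ := hi
    exact j.2
  · obtain ⟨i, hi⟩ := Function.ne_iff.mp hx0
    exact ⟨i, by simpa using hi⟩
  · intro k
    have hk := hx k
    simp only [f, map_sum, map_mul, map_pow, MvPolynomial.eval_C, MvPolynomial.eval_X] at hk
    rw [Finset.sum_map, Finset.sum_filter]
    refine Eq.trans (Finset.sum_congr rfl fun i _ => ?_) hk
    by_cases hi : x i = 0
    · simp [hi]
    · simp [hi, hsq]

theorem exists_zero_sum_subset_of_five_le {ι : Type*} (s : Finset ι) (w : ι → ZMod 3 × ZMod 3)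
    (h : 5 ≤ s.card) : ∃ t ⊆ s, t.Nonempty ∧ ∑ i ∈ t, w i = 0 := by
  obtain ⟨t, hts, hne, ht⟩ := exists_zero_sum_subset s
    (![fun i => (w i).1, fun i => (w i).2] : Fin 2 → ι → ZMod 3) (by simp; omega)
  exact ⟨t, hts, hne, Prod.ext (by simpa [Prod.fst_sum] using ht 0)
    (by simpa [Prod.snd_sum] using ht 1)⟩

/-- Setting one element aside leaves at least five, which contain a zero-sum subset; its complement
contains the element set aside. -/
theorem exists_zero_sum_split {ι : Type*} [DecidableEq ι] (s : Finset ι)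
    (w : ι → ZMod 3 × ZMod 3) (h : 6 ≤ s.card) (hs : ∑ i ∈ s, w i = 0) :
    ∃ t ⊆ s, t.Nonempty ∧ (s \ t).Nonempty ∧ ∑ i ∈ t, w i = 0 ∧ ∑ i ∈ s \ t, w i = 0 := by
  obtain ⟨x, hx⟩ : s.Nonempty := Finset.card_pos.mp (by omega)
  obtain ⟨t, hts, hne, ht⟩ := exists_zero_sum_subset_of_five_le (s.erase x) w
    (by rw [Finset.card_erase_of_mem hx]; omega)
  have hts' : t ⊆ s := hts.trans (Finset.erase_subset _ _)
  refine ⟨t, hts', hne, ⟨x, ?_⟩, ht, ?_⟩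
  · rw [Finset.mem_sdiff]
    exact ⟨hx, fun hxt => (Finset.mem_erase.mp (hts hxt)).1 rfl⟩
  · have := Finset.sum_sdiff (f := w) hts'
    rwa [ht, add_zero, hs] at this

/-- Adding a third weight constantly equal to 1 forces the zero-sum subset of seven elements to have
size 3 or 6; one of size 6 splits, and one of the two parts has at most three elements. -/
theorem exists_short_zero_sum_subset {ι : Type*} (s : Finset ι) (w : ι → ZMod 3 × ZMod 3)
    (h : 7 ≤ s.card) : ∃ t ⊆ s, t.Nonempty ∧ t.card ≤ 3 ∧ ∑ i ∈ t, w i = 0 := by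
  classical
  obtain ⟨s', hs's, hcard⟩ := Finset.exists_subset_card_eq h
  obtain ⟨t, hts, hne, ht⟩ := exists_zero_sum_subset s'
    (![fun i => (w i).1, fun i => (w i).2, fun _ => 1] : Fin 3 → ι → ZMod 3)
    (by simp [hcard])
  have hw : ∑ i ∈ t, w i = 0 := Prod.ext (by simpa [Prod.fst_sum] using ht 0)
    (by simpa [Prod.snd_sum] using ht 1)
  have h3 : 3 ∣ t.card := by
    have := ht 2
    simpa [ZMod.natCast_eq_zero_iff] using this
  have hle : t.card ≤ 7 := hcard ▸ Finset.card_le_card hts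
  have htpos := Finset.card_pos.mpr hne
  by_cases h4 : t.card ≤ 3
  · exact ⟨t, hts.trans hs's, hne, h4, hw⟩
  · obtain ⟨r, hrt, hr, hr', h1, h2⟩ := exists_zero_sum_split t w (by omega) hw
    have hc := Finset.card_sdiff_add_card_eq_card hrt
    by_cases h5 : r.card ≤ 3
    · exact ⟨r, (hrt.trans hts).trans hs's, hr, h5, h1⟩
    · exact ⟨t \ r, (Finset.sdiff_subset.trans hts).trans hs's, hr', by omega, h2⟩

/-- A zero-sum sequence of length at least `12` over `(ℤ/3)²` is the concatenation of four
nonempty zero-sum sequences. -/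
theorem exists_four_zero_sum {ι M : Type*} [CommMonoid M] (s : Finset ι)
    (w : ι → ZMod 3 × ZMod 3) (e : ι → M) (h : 12 ≤ s.card) (hs : ∑ i ∈ s, w i = 0) :
    ∃ t : Fin 4 → Finset ι, (∀ k, (t k).Nonempty) ∧ (∀ k, ∑ i ∈ t k, w i = 0) ∧
      ∑ k, (t k).card = s.card ∧ ∏ k, ∏ i ∈ t k, e i = ∏ i ∈ s, e i := by
  classical
  have hsub : ∀ s t : Finset ι, t ⊆ s → ∑ i ∈ s, w i = 0 → ∑ i ∈ t, w i = 0 →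
      ∑ i ∈ s \ t, w i = 0 := fun s t hts hs ht => by
    have := Finset.sum_sdiff (f := w) hts
    rwa [ht, add_zero, hs] at this
  -- Removing two pieces of size at most 3 from at least 12 elements leaves at least 6, enough for a
  -- final split in two.
  obtain ⟨t₁, h₁, n₁, c₁, z₁⟩ := exists_short_zero_sum_subset s w (by omega)
  have d₁ := Finset.card_sdiff_add_card_eq_card h₁
  obtain ⟨t₂, h₂, n₂, c₂, z₂⟩ := exists_short_zero_sum_subset (s \ t₁) w (by omega)
  have d₂ := Finset.card_sdiff_add_card_eq_card h₂
  obtain ⟨t₃, h₃, n₃, n₄, z₃, z₄⟩ := exists_zero_sum_split ((s \ t₁) \ t₂) w (by omega)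
    (hsub _ _ h₂ (hsub _ _ h₁ hs z₁) z₂)
  have d₃ := Finset.card_sdiff_add_card_eq_card h₃
  refine ⟨![t₁, t₂, t₃, ((s \ t₁) \ t₂) \ t₃], ?_, ?_, ?_, ?_⟩
  · intro k; fin_cases k <;> assumption
  · intro k; fin_cases k <;> assumption
  · simp [Fin.sum_univ_four]; omega
  · simp only [Fin.prod_univ_four, Matrix.cons_val]
    rw [← Finset.prod_sdiff h₁, ← Finset.prod_sdiff h₂, ← Finset.prod_sdiff h₃]
    ac_rfl

/-! ### The action on polynomials, the transfer, and Benson's argument. -/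

section Action

variable {K G : Type*} [Field K] [Group G] {n : ℕ} (ψ : G →* GL (Fin n) K)

theorem polyAct_one (f : MvPolynomial (Fin n) K) : polyAct ψ 1 f = f := by
  have : polyAct ψ 1 = AlgHom.id K _ := by
    ext j : 1
    simp [polyAct, Matrix.one_apply, Finset.sum_ite_eq]
  rw [this]; rfl

theorem polyAct_isHomogeneous (g : G) {f : MvPolynomial (Fin n) K} {d : ℕ}
    (hf : f.IsHomogeneous d) : (polyAct ψ g f).IsHomogeneous d := by
  have := hf.aeval (fun j => ∑ i, MvPolynomial.C ((ψ g⁻¹ : Matrix (Fin n) (Fin n) K) j i) *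
    MvPolynomial.X i) fun j => MvPolynomial.IsHomogeneous.sum _ _ _ fun i _ =>
      MvPolynomial.isHomogeneous_C_mul_X _ _
  rwa [one_mul] at this

theorem totalDegree_polyAct_le (g : G) (f : MvPolynomial (Fin n) K) :
    (polyAct ψ g f).totalDegree ≤ f.totalDegree := by
  conv_lhs => rw [← MvPolynomial.sum_homogeneousComponent f]
  rw [map_sum]
  refine MvPolynomial.totalDegree_finsetSum_le fun i hi => ?_
  exact (polyAct_isHomogeneous ψ g
    (MvPolynomial.homogeneousComponent_isHomogeneous i f)).totalDegree_le.trans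
    (by simpa [Nat.lt_succ_iff] using hi)

theorem homogeneousComponent_polyAct (g : G) (f : MvPolynomial (Fin n) K) (d : ℕ) :
    MvPolynomial.homogeneousComponent d (polyAct ψ g f) =
      polyAct ψ g (MvPolynomial.homogeneousComponent d f) := by
  conv_lhs => rw [← MvPolynomial.sum_homogeneousComponent f, map_sum, map_sum]
  rw [Finset.sum_congr rfl fun i _ => MvPolynomial.homogeneousComponent_of_mem
    (polyAct_isHomogeneous ψ g (MvPolynomial.homogeneousComponent_isHomogeneous i f))]
  rw [Finset.sum_ite_eq]
  split_ifs with h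
  · rfl
  · rw [MvPolynomial.homogeneousComponent_eq_zero _ _ (by simpa using h), map_zero]

theorem homogeneousComponent_mem_polyInvariants {f : MvPolynomial (Fin n) K}
    (hf : f ∈ polyInvariants ψ) (d : ℕ) :
    MvPolynomial.homogeneousComponent d f ∈ polyInvariants ψ := fun g => by
  rw [← homogeneousComponent_polyAct, hf g]

section Transfer

variable [Fintype G]

/-- The transfer `f ↦ ∑ g, g • f`. -/
noncomputable def polyTransfer : MvPolynomial (Fin n) K →ₗ[K] MvPolynomial (Fin n) K :=
  ∑ g : G, (polyAct ψ g).toLinearMap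

theorem polyTransfer_apply (f : MvPolynomial (Fin n) K) :
    polyTransfer ψ f = ∑ g : G, polyAct ψ g f := by
  simp [polyTransfer]

theorem polyTransfer_mul_of_mem (f : MvPolynomial (Fin n) K) {p : MvPolynomial (Fin n) K}
    (hp : p ∈ polyInvariants ψ) : polyTransfer ψ (f * p) = polyTransfer ψ f * p := by
  simp only [polyTransfer_apply, map_mul, Finset.sum_mul]
  exact Finset.sum_congr rfl fun g _ => by rw [hp g]

theorem polyTransfer_of_mem {p : MvPolynomial (Fin n) K} (hp : p ∈ polyInvariants ψ) :
    polyTransfer ψ p = (Fintype.card G : K) • p := by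
  rw [polyTransfer_apply, Finset.sum_congr rfl fun g _ => hp g]
  simp [Nat.cast_smul_eq_nsmul]

theorem polyTransfer_isHomogeneous {f : MvPolynomial (Fin n) K} {d : ℕ}
    (hf : f.IsHomogeneous d) : (polyTransfer ψ f).IsHomogeneous d := by
  rw [polyTransfer_apply]
  exact MvPolynomial.IsHomogeneous.sum _ _ _ fun g _ => polyAct_isHomogeneous ψ g hf

theorem totalDegree_polyTransfer_le (f : MvPolynomial (Fin n) K) :
    (polyTransfer ψ f).totalDegree ≤ f.totalDegree := by
  rw [polyTransfer_apply]
  exact MvPolynomial.totalDegree_finsetSum_le fun g _ => totalDegree_polyAct_le ψ g f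

theorem eval_polyTransfer (f : MvPolynomial (Fin n) K) (v : Fin n → K) :
    MvPolynomial.eval v (polyTransfer ψ f) =
      ∑ g : G, MvPolynomial.eval ((ψ g : Matrix (Fin n) (Fin n) K) *ᵥ v) f := by
  simp only [polyTransfer_apply, map_sum, eval_polyAct]
  exact Fintype.sum_equiv (Equiv.inv G) _ _ fun g => rfl

end Transfer

variable [CharZero K]

theorem polyAct_mul (g h : G) (f : MvPolynomial (Fin n) K) :
    polyAct ψ (g * h) f = polyAct ψ g (polyAct ψ h f) := by
  refine MvPolynomial.funext fun v => ?_
  simp only [eval_polyAct, mul_inv_rev, map_mul, Units.val_mul, Matrix.mulVec_mulVec]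

theorem mem_polyInvariants_iff_eval {f : MvPolynomial (Fin n) K} :
    f ∈ polyInvariants ψ ↔ ∀ (g : G) (v : Fin n → K),
      MvPolynomial.eval ((ψ g : Matrix (Fin n) (Fin n) K) *ᵥ v) f = MvPolynomial.eval v f := by
  constructor
  · intro h g v
    have := h g⁻¹
    conv_rhs => rw [← this, eval_polyAct, inv_inv]
  · intro h g
    exact MvPolynomial.funext fun v => by rw [eval_polyAct, h]

variable [Fintype G]

theorem polyTransfer_polyAct (h : G) (f : MvPolynomial (Fin n) K) :
    polyTransfer ψ (polyAct ψ h f) = polyTransfer ψ f := by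
  simp only [polyTransfer_apply, ← polyAct_mul]
  exact Fintype.sum_equiv (Equiv.mulRight h) _ _ fun g => rfl

theorem polyTransfer_mem (f : MvPolynomial (Fin n) K) : polyTransfer ψ f ∈ polyInvariants ψ := by
  intro h
  simp only [polyTransfer_apply, map_sum, ← polyAct_mul]
  exact Fintype.sum_equiv (Equiv.mulLeft h) _ _ fun g => rfl

/-- Benson's argument: the transfer of a product of four homogeneous polynomials of positive
degree, three of which satisfy the indicated invariance condition, is a polynomial in transfers of
lower degree. -/
theorem polyTransfer_mul_mem_of_cover (s : Fin 3 → G)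
    (S : Subalgebra K (MvPolynomial (Fin n) K)) (u : Fin 4 → MvPolynomial (Fin n) K)
    (k : Fin 4 → ℕ) (hk : ∀ i, 0 < k i) (hu : ∀ i, (u i).IsHomogeneous (k i))
    (hs : ∀ g, ∃ i : Fin 3, polyAct ψ (g * s i) (u i.castSucc) = u i.castSucc)
    (hS : ∀ p d, MvPolynomial.IsHomogeneous p d → 0 < d → d < ∑ i, k i → polyTransfer ψ p ∈ S) :
    polyTransfer ψ (∏ i, u i) ∈ S := by
  set u0 := u 0 with hu0
  set u1 := u 1 with hu1
  set u2 := u 2 with hu2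
  set u3 := u 3 with hu3
  set v0 := polyAct ψ (s 0) u0 with hv0
  set v1 := polyAct ψ (s 1) u1 with hv1
  set v2 := polyAct ψ (s 2) u2 with hv2
  have U0 : u0.IsHomogeneous (k 0) := hu 0
  have U1 : u1.IsHomogeneous (k 1) := hu 1
  have U2 : u2.IsHomogeneous (k 2) := hu 2
  have U3 : u3.IsHomogeneous (k 3) := hu 3
  have V0 : v0.IsHomogeneous (k 0) := polyAct_isHomogeneous ψ _ U0
  have V1 : v1.IsHomogeneous (k 1) := polyAct_isHomogeneous ψ _ U1
  have V2 : v2.IsHomogeneous (k 2) := polyAct_isHomogeneous ψ _ U2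
  have p0 := hk 0
  have p1 := hk 1
  have p2 := hk 2
  have p3 := hk 3
  rw [Fin.sum_univ_four] at hS
  -- For every `g` one of the first three factors vanishes, by the covering condition.
  have hzero : ∑ g : G, (u0 - polyAct ψ g v0) * (u1 - polyAct ψ g v1) *
      (u2 - polyAct ψ g v2) * u3 = 0 := by
    refine Finset.sum_eq_zero fun g _ => ?_
    obtain ⟨i, hi⟩ := hs g
    rw [polyAct_mul] at hi
    fin_cases i
    · have : polyAct ψ g v0 = u0 := hi
      simp [this]
    · have : polyAct ψ g v1 = u1 := hi
      simp [this]
    · have : polyAct ψ g v2 = u2 := hi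
      simp [this]
  have hexp : ∀ g : G, (u0 - polyAct ψ g v0) * (u1 - polyAct ψ g v1) *
      (u2 - polyAct ψ g v2) * u3 = u0 * u1 * u2 * u3
        - u1 * u2 * u3 * polyAct ψ g v0 - u0 * u2 * u3 * polyAct ψ g v1
        - u0 * u1 * u3 * polyAct ψ g v2 + u0 * u3 * polyAct ψ g (v1 * v2)
        + u1 * u3 * polyAct ψ g (v0 * v2) + u2 * u3 * polyAct ψ g (v0 * v1)
        - u3 * polyAct ψ g (v0 * v1 * v2) := fun g => by
    simp only [map_mul]; ring
  rw [Finset.sum_congr rfl fun g _ => hexp g] at hzero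
  simp only [Finset.sum_sub_distrib, Finset.sum_add_distrib, ← Finset.mul_sum,
    ← polyTransfer_apply, Finset.sum_const, Finset.card_univ, mul_smul_comm] at hzero
  -- Applying the transfer to the expanded identity turns each term into a product of two transfers
  -- of smaller positive degree, except the first, which is `|G|` times the transfer sought.
  have hT := congrArg (polyTransfer ψ) hzero
  simp only [map_sub, map_add, map_nsmul, map_zero,
    polyTransfer_mul_of_mem ψ _ (polyTransfer_mem ψ _)] at hT
  have key : (Fintype.card G : K) • polyTransfer ψ (u0 * u1 * u2 * u3) ∈ S := by
    rw [Nat.cast_smul_eq_nsmul]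
    have : Fintype.card G • polyTransfer ψ (u0 * u1 * u2 * u3) =
        polyTransfer ψ (u1 * u2 * u3) * polyTransfer ψ v0
        + polyTransfer ψ (u0 * u2 * u3) * polyTransfer ψ v1
        + polyTransfer ψ (u0 * u1 * u3) * polyTransfer ψ v2
        - polyTransfer ψ (u0 * u3) * polyTransfer ψ (v1 * v2)
        - polyTransfer ψ (u1 * u3) * polyTransfer ψ (v0 * v2)
        - polyTransfer ψ (u2 * u3) * polyTransfer ψ (v0 * v1)
        + polyTransfer ψ u3 * polyTransfer ψ (v0 * v1 * v2) := by
      linear_combination hT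
    rw [this]
    refine S.add_mem (S.sub_mem (S.sub_mem (S.sub_mem (S.add_mem (S.add_mem
      (S.mul_mem (hS _ _ ((U1.mul U2).mul U3) ?_ ?_) (hS _ _ V0 ?_ ?_))
      (S.mul_mem (hS _ _ ((U0.mul U2).mul U3) ?_ ?_) (hS _ _ V1 ?_ ?_)))
      (S.mul_mem (hS _ _ ((U0.mul U1).mul U3) ?_ ?_) (hS _ _ V2 ?_ ?_)))
      (S.mul_mem (hS _ _ (U0.mul U3) ?_ ?_) (hS _ _ (V1.mul V2) ?_ ?_)))
      (S.mul_mem (hS _ _ (U1.mul U3) ?_ ?_) (hS _ _ (V0.mul V2) ?_ ?_)))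
      (S.mul_mem (hS _ _ (U2.mul U3) ?_ ?_) (hS _ _ (V0.mul V1) ?_ ?_)))
      (S.mul_mem (hS _ _ U3 ?_ ?_) (hS _ _ ((V0.mul V1).mul V2) ?_ ?_)) <;> omega
  have hc : (Fintype.card G : K) ≠ 0 := Nat.cast_ne_zero.mpr Fintype.card_ne_zero
  have := S.smul_mem key (Fintype.card G : K)⁻¹
  rwa [inv_smul_smul₀ hc, ← Fin.prod_univ_four u] at this

end Action

/-! ### Diagonalization of maps of order 3. -/

section Eigen

variable {K M : Type*} [Field K] [AddCommGroup M] [Module K M]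

theorem primitive_three_pow_add {ζ : K} (hζ : ζ ^ 3 = 1) (x y : ZMod 3) :
    ζ ^ (x + y).val = ζ ^ x.val * ζ ^ y.val := by
  rw [ZMod.val_add, ← pow_add, ← pow_eq_pow_mod _ hζ]

/-- A linear map of order `3` stabilizing a subspace `N` is diagonalizable on `N`. -/
theorem mem_span_eigenvectors_of_cube [CharZero K] {ζ : K} (hζ : IsPrimitiveRoot ζ 3) (T : M →ₗ[K] M)
    (N : Submodule K M) (hT : ∀ p ∈ N, T (T (T p)) = p) (hN : ∀ p ∈ N, T p ∈ N) {p : M}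
    (hp : p ∈ N) :
    p ∈ Submodule.span K {q | q ∈ N ∧ ∃ i : ZMod 3, T q = ζ ^ i.val • q} := by
  have h3 : ζ ^ 3 = 1 := hζ.pow_eq_one
  have hs : 1 + ζ + ζ ^ 2 = 0 := by
    have := hζ.geom_sum_eq_zero (by norm_num)
    simpa [Finset.sum_range_succ] using this
  -- The projection to the `ζ^i`-eigenspace, up to the factor 3; the exponents `2i` and `i` stand
  -- for `-i` and `-2i`.
  have hmem : ∀ i : ZMod 3, p + ζ ^ (2 * i.val) • T p + ζ ^ i.val • T (T p) ∈
      Submodule.span K {q | q ∈ N ∧ ∃ i : ZMod 3, T q = ζ ^ i.val • q} := fun i => by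
    refine Submodule.subset_span ⟨N.add_mem (N.add_mem hp (N.smul_mem _ (hN _ hp)))
      (N.smul_mem _ (hN _ (hN _ hp))), i, ?_⟩
    have h3i : (ζ ^ i.val) ^ 3 = 1 := by rw [← pow_mul, mul_comm, pow_mul, h3, one_pow]
    simp only [map_add, map_smul, hT p hp, smul_add, smul_smul]
    rw [mul_comm 2, pow_mul, ← pow_succ', h3i, one_smul, ← pow_two]
    abel
  have hsum : p = (3 : K)⁻¹ • ((p + ζ ^ (2 * (0 : ZMod 3).val) • T p + ζ ^ (0 : ZMod 3).val • T (T p))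
      + (p + ζ ^ (2 * (1 : ZMod 3).val) • T p + ζ ^ (1 : ZMod 3).val • T (T p))
      + (p + ζ ^ (2 * (2 : ZMod 3).val) • T p + ζ ^ (2 : ZMod 3).val • T (T p))) := by
    have v0 : (0 : ZMod 3).val = 0 := rfl
    have v1 : (1 : ZMod 3).val = 1 := rfl
    have v2 : (2 : ZMod 3).val = 2 := rfl
    simp only [v0, v1, v2]
    have e1 : (3 : K)⁻¹ * 3 = 1 := by norm_num
    have e4 : ζ ^ (2 * 2) = ζ := by linear_combination ζ * h3
    rw [e4]
    match_scalars
    · linear_combination -e1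
    · linear_combination (-(3 : K)⁻¹) * hs
    · linear_combination (-(3 : K)⁻¹) * hs
  rw [hsum]
  exact Submodule.smul_mem _ _ (Submodule.add_mem _ (Submodule.add_mem _ (hmem 0) (hmem 1))
    (hmem 2))

end Eigen

/-! ### Finite computations in the group. -/

instance : Fintype M27 := Fintype.ofEquiv _ SemidirectProduct.equivProd.symm

theorem M27.card : Fintype.card M27 = 27 := by
  rw [Fintype.card_congr SemidirectProduct.equivProd, Fintype.card_prod, Fintype.card_multiplicative,
    Fintype.card_multiplicative, ZMod.card, ZMod.card]

/-- The powers `1, a, a²` represent the cosets of `⟨a³, b⟩`; this is the covering condition needed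
in Benson's argument. -/
theorem M27.exists_mul_pow_a (g : M27) :
    ∃ i : Fin 3, ∃ k l : Fin 3, g * M27.a ^ (i : ℕ) = (M27.a ^ 3) ^ (k : ℕ) * M27.b ^ (l : ℕ) := by
  have h : ∀ (x : ZMod 9) (y : ZMod 3), ∃ i : Fin 3, ∃ k l : Fin 3,
      (⟨.ofAdd x, .ofAdd y⟩ : M27) * M27.a ^ (i : ℕ) =
        (M27.a ^ 3) ^ (k : ℕ) * M27.b ^ (l : ℕ) := by
    decide
  exact h g.left.toAdd g.right.toAdd

theorem M27.commute_cube : M27.a ^ 3 * M27.b = M27.b * M27.a ^ 3 := by decide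

/-! ### Generation in degree 11. -/

section Upper

variable {K : Type*} [Field K] {n : ℕ} (ψ : M27 →* GL (Fin n) K)

/-- `p` is an eigenvector for `a³` and `b`, with eigenvalues `ζ ^ w.1` and `ζ ^ w.2`. -/
def HasWeight (ζ : K) (w : ZMod 3 × ZMod 3) (p : MvPolynomial (Fin n) K) : Prop :=
  polyAct ψ (M27.a ^ 3) p = ζ ^ w.1.val • p ∧ polyAct ψ M27.b p = ζ ^ w.2.val • p

variable {ψ} {ζ : K}

theorem HasWeight.prod (hζ : ζ ^ 3 = 1) {ι : Type*} (s : Finset ι) (w : ι → ZMod 3 × ZMod 3)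
    (e : ι → MvPolynomial (Fin n) K) (h : ∀ i ∈ s, HasWeight ψ ζ (w i) (e i)) :
    HasWeight ψ ζ (∑ i ∈ s, w i) (∏ i ∈ s, e i) := by
  classical
  induction s using Finset.induction_on with
  | empty => simp [HasWeight]
  | insert i s hi ih =>
    obtain ⟨h1, h2⟩ := ih fun j hj => h j (Finset.mem_insert_of_mem hj)
    obtain ⟨h3, h4⟩ := h i (Finset.mem_insert_self i s)
    rw [Finset.sum_insert hi, Finset.prod_insert hi]
    refine ⟨?_, ?_⟩
    · rw [map_mul, h1, h3, Prod.fst_add, primitive_three_pow_add hζ, smul_mul_smul_comm]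
    · rw [map_mul, h2, h4, Prod.snd_add, primitive_three_pow_add hζ, smul_mul_smul_comm]

variable [CharZero K]

theorem polyAct_pow_of_eq {G : Type*} [Group G] {ψ : G →* GL (Fin n) K} {g : G}
    {p : MvPolynomial (Fin n) K} (h : polyAct ψ g p = p) (k : ℕ) : polyAct ψ (g ^ k) p = p := by
  induction k with
  | zero => rw [pow_zero, polyAct_one]
  | succ k ih => rw [pow_succ, polyAct_mul, h, ih]

/-- The transfer does not change when its argument is moved by a group element, yet `a³` or `b`
multiplies `p` by a scalar different from 1. -/
theorem HasWeight.polyTransfer_eq_zero (hζ : IsPrimitiveRoot ζ 3) {w : ZMod 3 × ZMod 3}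
    {p : MvPolynomial (Fin n) K} (h : HasWeight ψ ζ w p) (hw : w ≠ 0) :
    polyTransfer ψ p = 0 := by
  have key : ∀ (g : M27) (x : ZMod 3), polyAct ψ g p = ζ ^ x.val • p → x ≠ 0 →
      polyTransfer ψ p = 0 := fun g x hg hx => by
    have h1 := polyTransfer_polyAct ψ g p
    rw [hg, map_smul] at h1
    have h2 : (ζ ^ x.val - 1) • polyTransfer ψ p = 0 := by rw [sub_smul, h1, one_smul, sub_self]
    refine (smul_eq_zero.mp h2).resolve_left (sub_ne_zero.mpr ?_)
    exact hζ.pow_ne_one_of_pos_of_lt ((ZMod.val_ne_zero x).mpr hx) (ZMod.val_lt x)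
  by_cases h1 : w.1 = 0
  · exact key _ _ h.2 fun h2 => hw (Prod.ext h1 h2)
  · exact key _ _ h.1 h1

theorem HasWeight.polyAct_mul_pow_a {p : MvPolynomial (Fin n) K} (h : HasWeight ψ ζ 0 p)
    (k l : ℕ) : polyAct ψ ((M27.a ^ 3) ^ k * M27.b ^ l) p = p := by
  obtain ⟨h1, h2⟩ := h
  rw [Prod.fst_zero, ZMod.val_zero, pow_zero, one_smul] at h1
  rw [Prod.snd_zero, ZMod.val_zero, pow_zero, one_smul] at h2
  rw [polyAct_mul, polyAct_pow_of_eq h2, polyAct_pow_of_eq h1]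

theorem homogeneousSubmodule_one_le_span (ψ : M27 →* GL (Fin n) K) (hζ : IsPrimitiveRoot ζ 3) :
    MvPolynomial.homogeneousSubmodule (Fin n) K 1 ≤
      Submodule.span K {q | q.IsHomogeneous 1 ∧ ∃ w, HasWeight ψ ζ w q} := by
  intro p hp
  have hc : ∀ p, polyAct ψ (M27.a ^ 3) (polyAct ψ (M27.a ^ 3) (polyAct ψ (M27.a ^ 3) p)) = p :=
    fun p => by
      rw [← polyAct_mul, ← polyAct_mul, show M27.a ^ 3 * (M27.a ^ 3) * M27.a ^ 3 = 1 by decide,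
        polyAct_one]
  have hb : ∀ p, polyAct ψ M27.b (polyAct ψ M27.b (polyAct ψ M27.b p)) = p :=
    fun p => by
      rw [← polyAct_mul, ← polyAct_mul, show M27.b * M27.b * M27.b = 1 by decide, polyAct_one]
  have h1 := mem_span_eigenvectors_of_cube hζ (polyAct ψ (M27.a ^ 3)).toLinearMap
    (MvPolynomial.homogeneousSubmodule (Fin n) K 1) (fun q _ => hc q) (fun q hq => polyAct_isHomogeneous ψ _ hq) hp
  refine (Submodule.span_le.mpr ?_) h1
  rintro q ⟨hq, i, hi⟩
  have hi' : polyAct ψ (M27.a ^ 3) q = ζ ^ i.val • q := hi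
  -- Since `b` commutes with `a³`, it preserves each eigenspace of `a³` on linear forms and can be
  -- diagonalized there.
  let N : Submodule K (MvPolynomial (Fin n) K) :=
    MvPolynomial.homogeneousSubmodule (Fin n) K 1 ⊓
      LinearMap.ker ((polyAct ψ (M27.a ^ 3)).toLinearMap - ζ ^ i.val • LinearMap.id)
  have hmemN : ∀ r, r ∈ N ↔ r.IsHomogeneous 1 ∧ polyAct ψ (M27.a ^ 3) r = ζ ^ i.val • r :=
    fun r => by
      rw [Submodule.mem_inf, LinearMap.mem_ker]
      simp [sub_eq_zero]
  have h2 := mem_span_eigenvectors_of_cube hζ (polyAct ψ M27.b).toLinearMap N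
    (fun r _ => hb r) (fun r hr => by
      rw [hmemN] at hr ⊢
      refine ⟨polyAct_isHomogeneous ψ _ hr.1, ?_⟩
      change polyAct ψ (M27.a ^ 3) (polyAct ψ M27.b r) = ζ ^ i.val • polyAct ψ M27.b r
      rw [← polyAct_mul, M27.commute_cube, polyAct_mul, hr.2, map_smul])
    ((hmemN q).mpr ⟨hq, hi'⟩)
  refine Submodule.span_mono ?_ h2
  rintro r ⟨hr, j, hj⟩
  rw [hmemN] at hr
  exact ⟨hr.1, (i, j), hr.2, hj⟩

-- Strong induction on the degree: by linearity only products of weight vectors matter, and from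
-- degree 12 on such a product either has zero transfer or splits into four factors invariant under
-- `⟨a³, b⟩`.
open scoped Pointwise in
theorem polyTransfer_mem_adjoin (ψ : M27 →* GL (Fin n) K) (hζ : IsPrimitiveRoot ζ 3) (d : ℕ)
    (p : MvPolynomial (Fin n) K) (hp : p.IsHomogeneous d) :
    polyTransfer ψ p ∈ Algebra.adjoin K (invariantsOfDegreeLE ψ 11) := by
  induction d using Nat.strong_induction_on generalizing p with
  | _ d ih =>
  by_cases hd : d ≤ 11
  · exact Algebra.subset_adjoin
      ⟨polyTransfer_mem ψ p, (polyTransfer_isHomogeneous ψ hp).totalDegree_le.trans hd⟩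
  have hp' : p ∈ Submodule.span K
      ({q | q.IsHomogeneous 1 ∧ ∃ w, HasWeight ψ ζ w q} ^ d) := by
    rw [← Submodule.span_pow]
    have : p ∈ MvPolynomial.homogeneousSubmodule (Fin n) K d := hp
    rw [← MvPolynomial.homogeneousSubmodule_one_pow] at this
    exact pow_le_pow_left' (homogeneousSubmodule_one_le_span ψ hζ) d this
  clear hp
  have hle : Submodule.span K ({q | q.IsHomogeneous 1 ∧ ∃ w, HasWeight ψ ζ w q} ^ d) ≤
      (Subalgebra.toSubmodule (Algebra.adjoin K (invariantsOfDegreeLE ψ 11))).comap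
        (polyTransfer ψ) := by
    rw [Submodule.span_le]
    intro q hq
    obtain ⟨e, rfl⟩ := Set.mem_pow.mp hq
    rw [List.prod_ofFn]
    choose hom w hw using fun i => (e i).2
    have hprod := HasWeight.prod hζ.pow_eq_one Finset.univ w (fun i => (e i).1) fun i _ => hw i
    change polyTransfer ψ _ ∈ Algebra.adjoin K (invariantsOfDegreeLE ψ 11)
    by_cases hsum : ∑ i, w i = 0
    · obtain ⟨t, hne, hz, hcard, ht⟩ := exists_four_zero_sum Finset.univ w (fun i => (e i).1)
        (by rw [Finset.card_fin]; omega) hsum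
      rw [Finset.card_fin] at hcard
      rw [← ht]
      refine polyTransfer_mul_mem_of_cover ψ (fun i => M27.a ^ (i : ℕ)) _ _
        (fun k => (t k).card) (fun k => Finset.card_pos.mpr (hne k)) (fun k => ?_) (fun g => ?_)
        fun q k hq _ hk => ih k (by omega) q hq
      · have := MvPolynomial.IsHomogeneous.prod (t k) (fun i => (e i).1) (fun _ => 1)
          fun i _ => hom i
        simpa using this
      · obtain ⟨i, k, l, h⟩ := M27.exists_mul_pow_a g
        refine ⟨i, ?_⟩
        have hi := HasWeight.prod hζ.pow_eq_one (t i.castSucc) w (fun i => (e i).1)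
          fun i _ => hw i
        rw [hz] at hi
        rw [h, hi.polyAct_mul_pow_a]
    · rw [hprod.polyTransfer_eq_zero hζ hsum]
      exact Subalgebra.zero_mem _
  exact hle hp'

/-- The invariants of `M₂₇` are generated in degree at most `11`. -/
theorem adjoin_invariantsOfDegreeLE_eleven (ψ : M27 →* GL (Fin n) K)
    (hζ : IsPrimitiveRoot ζ 3) :
    Algebra.adjoin K (invariantsOfDegreeLE ψ 11) = polyInvariants ψ := by
  refine le_antisymm (Algebra.adjoin_le fun f hf => hf.1) fun f hf => ?_
  rw [← MvPolynomial.sum_homogeneousComponent f]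
  refine Subalgebra.sum_mem _ fun d _ => ?_
  have h := polyTransfer_mem_adjoin ψ hζ d _
    (MvPolynomial.homogeneousComponent_isHomogeneous d f)
  rw [polyTransfer_of_mem ψ (homogeneousComponent_mem_polyInvariants ψ hf d)] at h
  have hc : (Fintype.card M27 : K) ≠ 0 := Nat.cast_ne_zero.mpr Fintype.card_ne_zero
  have := Subalgebra.smul_mem _ h (Fintype.card M27 : K)⁻¹
  rwa [inv_smul_smul₀ hc] at this

end Upper

/-! ### Construction of representations from the presentation. -/

theorem M27.exists_hom {H : Type*} [Group H] (A B : H) (hA : A ^ 9 = 1) (hB : B ^ 3 = 1)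
    (hAB : B * A * B⁻¹ = A ^ 4) : ∃ φ : M27 →* H, φ M27.a = A ∧ φ M27.b = B := by
  obtain ⟨e, ha, hb⟩ := M27.presentation
  have hF : ∀ r ∈ m27Relators, FreeGroup.lift ![A, B] r = 1 := by
    rintro r (rfl | rfl | rfl)
    · simpa using hA
    · simpa using hB
    · simpa [mul_inv_eq_one] using hAB
  refine ⟨(PresentedGroup.toGroup hF).comp e.symm.toMonoidHom, ?_, ?_⟩
  · simp [← ha]
  · simp [← hb]

theorem M27.exists_matrix_hom {R ι : Type*} [CommRing R] [Fintype ι] [DecidableEq ι]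
    (A B : Matrix ι ι R) (hA : A ^ 9 = 1) (hB : B ^ 3 = 1) (hAB : B * A = A ^ 4 * B) :
    ∃ ψ : M27 →* GL ι R, (ψ M27.a : Matrix ι ι R) = A ∧ (ψ M27.b : Matrix ι ι R) = B := by
  let A' : GL ι R := ⟨A, A ^ 8, by rw [← pow_succ', hA], by rw [← pow_succ, hA]⟩
  let B' : GL ι R := ⟨B, B ^ 2, by rw [← pow_succ', hB], by rw [← pow_succ, hB]⟩
  obtain ⟨ψ, ha, hb⟩ := M27.exists_hom A' B' (Units.ext hA) (Units.ext hB)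
    (by rw [mul_inv_eq_iff_eq_mul]; exact Units.ext hAB)
  exact ⟨ψ, by rw [ha], by rw [hb]⟩

theorem M27.eq_pow_mul_pow (g : M27) :
    g = M27.a ^ g.left.toAdd.val * M27.b ^ g.right.toAdd.val := by
  have h : ∀ (x : ZMod 9) (y : ZMod 3),
      (⟨.ofAdd x, .ofAdd y⟩ : M27) = M27.a ^ x.val * M27.b ^ y.val := by decide
  exact h g.left.toAdd g.right.toAdd

theorem M27.exists_eq_pow_mul_pow (g : M27) : ∃ i < 9, ∃ j < 3, g = M27.a ^ i * M27.b ^ j :=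
  ⟨_, ZMod.val_lt _, _, ZMod.val_lt _, g.eq_pow_mul_pow⟩

section Reps

variable {K : Type*} [Field K]

/-- The three-dimensional representation of `M₂₇` induced from the character `a ↦ η` of `⟨a⟩`. -/
theorem exists_rep_three {η : K} (hη : η ^ 9 = 1) :
    ∃ ψ : M27 →* GL (Fin 3) K, ∀ x : Fin 3 → K,
      (ψ M27.a : Matrix (Fin 3) (Fin 3) K) *ᵥ x = ![η * x 0, η ^ 4 * x 1, η ^ 7 * x 2] ∧
      (ψ M27.b : Matrix (Fin 3) (Fin 3) K) *ᵥ x = ![x 1, x 2, x 0] := by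
  obtain ⟨ψ, ha, hb⟩ := M27.exists_matrix_hom (Matrix.diagonal ![η, η ^ 4, η ^ 7])
    !![0, 1, 0; 0, 0, 1; 1, 0, 0] (by
      rw [Matrix.diagonal_pow, ← Matrix.diagonal_one]
      congr 1
      funext i
      fin_cases i <;> simp [← pow_mul, pow_eq_pow_mod _ hη]) (by
      ext i j
      fin_cases i <;> fin_cases j <;>
        simp [pow_succ, Matrix.mul_apply, Fin.sum_univ_three]) (by
      rw [Matrix.diagonal_pow]
      ext i j
      fin_cases i <;> fin_cases j <;>
        simp [Matrix.diagonal_mul, Matrix.mul_diagonal, ← pow_mul, pow_eq_pow_mod 16 hη,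
          pow_eq_pow_mod 28 hη])
  refine ⟨ψ, fun x => ⟨?_, ?_⟩⟩
  · rw [ha]
    funext i
    fin_cases i <;> simp [Matrix.mulVec_diagonal]
  · rw [hb]
    funext i
    fin_cases i <;> simp [Matrix.mulVec, dotProduct, Fin.sum_univ_three]

/-- The direct sum of the three-dimensional representation and the character `a ↦ 1`,
`b ↦ η ^ 3`. -/
theorem exists_rep_four {η : K} (hη : η ^ 9 = 1) :
    ∃ ψ : M27 →* GL (Fin 4) K, ∀ x : Fin 4 → K,
      (ψ M27.a : Matrix (Fin 4) (Fin 4) K) *ᵥ x = ![η * x 0, η ^ 4 * x 1, η ^ 7 * x 2, x 3] ∧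
      (ψ M27.b : Matrix (Fin 4) (Fin 4) K) *ᵥ x = ![x 1, x 2, x 0, η ^ 3 * x 3] := by
  obtain ⟨ψ, ha, hb⟩ := M27.exists_matrix_hom (Matrix.diagonal ![η, η ^ 4, η ^ 7, 1])
    !![0, 1, 0, 0; 0, 0, 1, 0; 1, 0, 0, 0; 0, 0, 0, η ^ 3] (by
      rw [Matrix.diagonal_pow, ← Matrix.diagonal_one]
      congr 1
      funext i
      fin_cases i <;> simp [← pow_mul, pow_eq_pow_mod _ hη]) (by
      ext i j
      fin_cases i <;> fin_cases j <;>
        simp [pow_succ, Matrix.mul_apply, Fin.sum_univ_four]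
      linear_combination hη) (by
      rw [Matrix.diagonal_pow]
      ext i j
      fin_cases i <;> fin_cases j <;>
        simp [Matrix.diagonal_mul, Matrix.mul_diagonal, ← pow_mul, pow_eq_pow_mod 16 hη,
          pow_eq_pow_mod 28 hη])
  refine ⟨ψ, fun x => ⟨?_, ?_⟩⟩
  · rw [ha]
    funext i
    fin_cases i <;> simp [Matrix.mulVec_diagonal]
  · rw [hb]
    funext i
    fin_cases i <;> simp [Matrix.mulVec, dotProduct, Fin.sum_univ_four]

end Reps

/-! ### Linear substitutions and invariance under generators. -/

section General

variable {K : Type*} [Field K]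

theorem totalDegree_aeval_le_of_linear {σ τ : Type*} (g : σ → MvPolynomial τ K)
    (hg : ∀ i, (g i).totalDegree ≤ 1) (f : MvPolynomial σ K) :
    (MvPolynomial.aeval g f).totalDegree ≤ f.totalDegree := by
  rw [MvPolynomial.aeval_def, MvPolynomial.eval₂_eq]
  refine MvPolynomial.totalDegree_finsetSum_le fun m hm => ?_
  refine (MvPolynomial.totalDegree_mul _ _).trans ?_
  rw [MvPolynomial.algebraMap_eq, MvPolynomial.totalDegree_C, zero_add]
  refine (MvPolynomial.totalDegree_finsetProd _ _).trans ?_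
  refine le_trans (Finset.sum_le_sum fun i _ => ?_) (MvPolynomial.le_totalDegree hm)
  exact (MvPolynomial.totalDegree_pow _ _).trans (by nlinarith [hg i])

theorem eval_aeval_mvPolynomial {σ τ : Type*} (g : σ → MvPolynomial τ K) (f : MvPolynomial σ K)
    (v : τ → K) : MvPolynomial.eval v (MvPolynomial.aeval g f) =
      MvPolynomial.eval (fun i => MvPolynomial.eval v (g i)) f := by
  induction f using MvPolynomial.induction_on with
  | C a => simp
  | add p q hp hq => rw [map_add, map_add, map_add, hp, hq]
  | mul_X p j hp =>
    rw [map_mul, map_mul, map_mul, hp, MvPolynomial.aeval_X, MvPolynomial.eval_X]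

theorem coeff_aeval_C_mul_X {σ : Type*} [Fintype σ] (μ : σ → K) (f : MvPolynomial σ K)
    (m : σ →₀ ℕ) :
    MvPolynomial.coeff m (MvPolynomial.aeval (fun j => MvPolynomial.C (μ j) * MvPolynomial.X j) f :
      MvPolynomial σ K) = (∏ j, μ j ^ m j) * MvPolynomial.coeff m f := by
  classical
  induction f using MvPolynomial.induction_on' with
  | monomial k c =>
    have : (MvPolynomial.aeval (fun j => MvPolynomial.C (μ j) * MvPolynomial.X j)
        (MvPolynomial.monomial k c) : MvPolynomial σ K) =
        MvPolynomial.monomial k ((∏ j, μ j ^ k j) * c) := by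
      rw [MvPolynomial.aeval_monomial, Finsupp.prod_fintype _ _ (by simp),
        MvPolynomial.monomial_eq (a := (∏ j, μ j ^ k j) * c), Finsupp.prod_fintype _ _ (by simp)]
      simp only [mul_pow, Finset.prod_mul_distrib, map_mul, map_prod, map_pow,
        MvPolynomial.algebraMap_eq]
      ring
    rw [this, MvPolynomial.coeff_monomial, MvPolynomial.coeff_monomial]
    split_ifs with h
    · rw [h]
    · rw [mul_zero]
  | add p q hp hq => rw [map_add, MvPolynomial.coeff_add, hp, hq, MvPolynomial.coeff_add, mul_add]

/-- Over an infinite field the two rescaled polynomials coincide, and a diagonal substitution only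
multiplies each coefficient. This is how invariance restricts the monomials that occur. -/
theorem prod_pow_mul_coeff_eq_of_eval_eq [Infinite K] {σ : Type*} [Fintype σ] (μ ν : σ → K)
    (f : MvPolynomial σ K)
    (h : ∀ v : σ → K, MvPolynomial.eval (μ * v) f = MvPolynomial.eval (ν * v) f) (m : σ →₀ ℕ) :
    (∏ j, μ j ^ m j) * MvPolynomial.coeff m f = (∏ j, ν j ^ m j) * MvPolynomial.coeff m f := by
  rw [← coeff_aeval_C_mul_X, ← coeff_aeval_C_mul_X]
  congr 1
  refine MvPolynomial.funext fun v => ?_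
  rw [eval_aeval_mvPolynomial, eval_aeval_mvPolynomial]
  simp only [map_mul, MvPolynomial.eval_C, MvPolynomial.eval_X]
  exact h v

theorem mem_polyInvariants_of_generators [CharZero K] {n : ℕ} {ψ : M27 →* GL (Fin n) K}
    {f : MvPolynomial (Fin n) K}
    (ha : ∀ v, MvPolynomial.eval ((ψ M27.a : Matrix (Fin n) (Fin n) K) *ᵥ v) f =
      MvPolynomial.eval v f)
    (hb : ∀ v, MvPolynomial.eval ((ψ M27.b : Matrix (Fin n) (Fin n) K) *ᵥ v) f =
      MvPolynomial.eval v f) : f ∈ polyInvariants ψ := by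
  rw [mem_polyInvariants_iff_eval]
  have hpow : ∀ g : M27, (∀ v, MvPolynomial.eval ((ψ g : Matrix (Fin n) (Fin n) K) *ᵥ v) f =
      MvPolynomial.eval v f) → ∀ (k : ℕ) (v), MvPolynomial.eval
        ((ψ (g ^ k) : Matrix (Fin n) (Fin n) K) *ᵥ v) f = MvPolynomial.eval v f := by
    intro g hg k
    induction k with
    | zero => simp
    | succ k ih =>
      intro v
      rw [pow_succ, map_mul, Units.val_mul, ← Matrix.mulVec_mulVec, ih, hg]
  intro g v
  rw [g.eq_pow_mul_pow, map_mul, Units.val_mul, ← Matrix.mulVec_mulVec, hpow _ ha, hpow _ hb]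

end General

/-! ### Lower bounds by restriction to a plane. -/

section Lower

variable {K : Type*} [Field K] [CharZero K]

/-- Restriction of polynomials in four variables to the plane `x₁ = x₂ = 0`. -/
noncomputable def restrictToPlane (K : Type*) [Field K] :
    MvPolynomial (Fin 4) K →ₐ[K] MvPolynomial (Fin 2) K :=
  MvPolynomial.aeval ![MvPolynomial.X 0, 0, 0, MvPolynomial.X 1]

omit [CharZero K] in
theorem eval_restrictToPlane (f : MvPolynomial (Fin 4) K) (s : Fin 2 → K) :
    MvPolynomial.eval s (restrictToPlane K f) = MvPolynomial.eval ![s 0, 0, 0, s 1] f := by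
  rw [restrictToPlane, eval_aeval_mvPolynomial]
  congr 1
  congr 1
  funext i
  fin_cases i <;> simp

omit [CharZero K] in
theorem totalDegree_restrictToPlane_le (f : MvPolynomial (Fin 4) K) :
    (restrictToPlane K f).totalDegree ≤ f.totalDegree :=
  totalDegree_aeval_le_of_linear _ (fun i => by fin_cases i <;> simp) f

variable {η : K} {ψ : M27 →* GL (Fin 4) K}

theorem coeff_restrictToPlane_ne_zero (hη : IsPrimitiveRoot η 9)
    (hψ : ∀ x : Fin 4 → K,
      (ψ M27.a : Matrix (Fin 4) (Fin 4) K) *ᵥ x = ![η * x 0, η ^ 4 * x 1, η ^ 7 * x 2, x 3] ∧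
      (ψ M27.b : Matrix (Fin 4) (Fin 4) K) *ᵥ x = ![x 1, x 2, x 0, η ^ 3 * x 3])
    {f : MvPolynomial (Fin 4) K} (hf : f ∈ polyInvariants ψ) {m : Fin 2 →₀ ℕ}
    (hm : MvPolynomial.coeff m (restrictToPlane K f) ≠ 0) :
    9 ∣ m 0 ∧ (m 0 = 0 → 3 ∣ m 1) := by
  rw [mem_polyInvariants_iff_eval] at hf
  constructor
  · have h := prod_pow_mul_coeff_eq_of_eval_eq ![η, 1] ![1, 1] (restrictToPlane K f) (fun v => by
      rw [eval_restrictToPlane, eval_restrictToPlane]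
      have := hf M27.a ![v 0, 0, 0, v 1]
      rw [(hψ _).1] at this
      simpa using this) m
    have h := mul_right_cancel₀ hm h
    rw [← hη.pow_eq_one_iff_dvd]
    simpa [Fin.prod_univ_two] using h
  · intro h0
    -- The plane is not stable under `b`, but its second axis is. The scaling factor 0 projects onto
    -- that axis, and `0 ^ 0 = 1` keeps the monomials with `m 0 = 0`.
    have h := prod_pow_mul_coeff_eq_of_eval_eq ![0, η ^ 3] ![0, 1] (restrictToPlane K f)
      (fun v => by
        rw [eval_restrictToPlane, eval_restrictToPlane]
        have := hf M27.b ![0, 0, 0, v 1]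
        rw [(hψ _).2] at this
        simpa using this) m
    have h := mul_right_cancel₀ hm h
    have h3 : η ^ (3 * m 1) = 1 := by simpa [Fin.prod_univ_two, h0, pow_mul] using h
    have := (hη.pow_eq_one_iff_dvd _).mp h3
    omega

/-- The vectors `(1,0,0,1)` and `(1,0,0,η³)` lie in different orbits, but agree on all invariants of
degree at most 9. -/
theorem ten_le_of_isSeparatingSet (hη : IsPrimitiveRoot η 9)
    (hψ : ∀ x : Fin 4 → K,
      (ψ M27.a : Matrix (Fin 4) (Fin 4) K) *ᵥ x = ![η * x 0, η ^ 4 * x 1, η ^ 7 * x 2, x 3] ∧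
      (ψ M27.b : Matrix (Fin 4) (Fin 4) K) *ᵥ x = ![x 1, x 2, x 0, η ^ 3 * x 3]) {d : ℕ}
    (hd : IsSeparatingSet ψ (invariantsOfDegreeLE ψ d)) : 10 ≤ d := by
  by_contra! hlt
  have h3 : η ^ 3 ≠ 1 := hη.pow_ne_one_of_pos_of_lt (by norm_num) (by norm_num)
  have hapow : ∀ (i : ℕ) (x : Fin 4 → K),
      ((ψ (M27.a ^ i) : Matrix (Fin 4) (Fin 4) K) *ᵥ x) 3 = x 3 ∧
      (x 0 = 0 → ((ψ (M27.a ^ i) : Matrix (Fin 4) (Fin 4) K) *ᵥ x) 0 = 0) := by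
    intro i
    induction i with
    | zero => simp
    | succ i ih =>
      intro x
      rw [pow_succ', map_mul, Units.val_mul, ← Matrix.mulVec_mulVec, (hψ _).1]
      refine ⟨(ih x).1, fun h0 => ?_⟩
      change η * _ = 0
      rw [(ih x).2 h0, mul_zero]
  have horb : vecOrbit ψ ![1, 0, 0, 1] ≠ vecOrbit ψ ![1, 0, 0, η ^ 3] := by
    intro h
    have hmem : ![1, 0, 0, η ^ 3] ∈ vecOrbit ψ ![1, 0, 0, 1] := by
      rw [h]
      exact ⟨1, by simp⟩
    obtain ⟨g, hg⟩ := hmem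
    obtain ⟨i, -, j, hj, rfl⟩ := g.exists_eq_pow_mul_pow
    simp only [map_mul, Units.val_mul, ← Matrix.mulVec_mulVec] at hg
    -- Powers of `a` preserve the last coordinate, while `b` and `b²` make coordinate 0 vanish.
    interval_cases j
    · have := congrFun hg 3
      rw [(hapow i _).1] at this
      simp at this
      exact h3 this.symm
    · have := congrFun hg 0
      rw [(hapow i _).2 (by rw [pow_one, (hψ _).2]; simp)] at this
      simp at this
    · have := congrFun hg 0
      rw [(hapow i _).2 (by
        rw [pow_two, map_mul, Units.val_mul, ← Matrix.mulVec_mulVec, (hψ _).2, (hψ _).2]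
        simp)] at this
      simp at this
  obtain ⟨f, ⟨hf, hdeg⟩, hne⟩ := hd _ _ horb
  apply hne
  have e1 := eval_restrictToPlane f ![1, 1]
  have e2 := eval_restrictToPlane f ![1, η ^ 3]
  simp only [Matrix.cons_val] at e1 e2
  rw [← e1, ← e2, MvPolynomial.eval_eq', MvPolynomial.eval_eq']
  refine Finset.sum_congr rfl fun m hm => ?_
  obtain ⟨h9, h0⟩ := coeff_restrictToPlane_ne_zero hη hψ hf (MvPolynomial.mem_support_iff.mp hm)
  have hle := (MvPolynomial.le_totalDegree hm).trans (totalDegree_restrictToPlane_le f)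
  rw [Finsupp.sum_fintype _ _ (by simp), Fin.sum_univ_two] at hle
  -- In degree at most 9, either `m 0 = 9` and `m 1 = 0`, or `m 0 = 0` and `3 ∣ m 1`.
  have : 9 ∣ 3 * m 1 := by omega
  have := (hη.pow_eq_one_iff_dvd _).mpr this
  simp [Fin.prod_univ_two, ← pow_mul, this]

/-- Polynomials in two variables all of whose monomials are restrictions of invariant monomials,
with the exception of `x₀⁹ x₁²`. -/
def planeSubalgebra (K : Type*) [Field K] : Subalgebra K (MvPolynomial (Fin 2) K) where
  carrier := {r | ∀ m, MvPolynomial.coeff m r ≠ 0 →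
    9 ∣ m 0 ∧ (m 0 = 0 → 3 ∣ m 1) ∧ ¬ (m 0 = 9 ∧ m 1 = 2)}
  mul_mem' := by
    intro p q hp hq m hm
    rw [MvPolynomial.coeff_mul] at hm
    obtain ⟨⟨x, y⟩, hxy, hne⟩ := Finset.exists_ne_zero_of_sum_ne_zero hm
    replace hxy := Finset.HasAntidiagonal.mem_antidiagonal.mp hxy
    obtain ⟨h1, h2, h3⟩ := hp x (left_ne_zero_of_mul hne)
    obtain ⟨h4, h5, h6⟩ := hq y (right_ne_zero_of_mul hne)
    simp only at hxy
    have e0 : x 0 + y 0 = m 0 := by rw [← hxy]; rfl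
    have e1 : x 1 + y 1 = m 1 := by rw [← hxy]; rfl
    -- If the product monomial were `x₀⁹x₁²`, one factor would have `x₀`-exponent 0, hence
    -- `x₁`-exponent a multiple of 3 that is at most 2, so 0; the other factor would be the excluded
    -- monomial.
    omega
  add_mem' := by
    intro p q hp hq m hm
    rw [MvPolynomial.coeff_add] at hm
    by_cases h : MvPolynomial.coeff m p = 0
    · exact hq m (by rwa [h, zero_add] at hm)
    · exact hp m h
  algebraMap_mem' := by
    intro c m hm
    rw [MvPolynomial.algebraMap_eq, MvPolynomial.coeff_C] at hm
    have : (0 : Fin 2 →₀ ℕ) = m := by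
      by_contra h
      exact hm (if_neg h)
    simp [← this]

theorem eleven_le_of_adjoin_eq (hη : IsPrimitiveRoot η 9)
    (hψ : ∀ x : Fin 4 → K,
      (ψ M27.a : Matrix (Fin 4) (Fin 4) K) *ᵥ x = ![η * x 0, η ^ 4 * x 1, η ^ 7 * x 2, x 3] ∧
      (ψ M27.b : Matrix (Fin 4) (Fin 4) K) *ᵥ x = ![x 1, x 2, x 0, η ^ 3 * x 3]) {d : ℕ}
    (hd : Algebra.adjoin K (invariantsOfDegreeLE ψ d) = polyInvariants ψ) : 11 ≤ d := by
  by_contra! hlt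
  have h9 : η ^ 9 = 1 := hη.pow_eq_one
  have hle : Algebra.adjoin K (invariantsOfDegreeLE ψ d) ≤
      (planeSubalgebra K).comap (restrictToPlane K) := by
    refine Algebra.adjoin_le fun f hf m hm => ?_
    obtain ⟨h1, h2⟩ := coeff_restrictToPlane_ne_zero hη hψ hf.1 hm
    have hle := (MvPolynomial.le_totalDegree (MvPolynomial.mem_support_iff.mpr hm)).trans
      ((totalDegree_restrictToPlane_le f).trans hf.2)
    rw [Finsupp.sum_fintype _ _ (by simp), Fin.sum_univ_two] at hle
    omega
  -- The sum of ninth powers is multiplied by `η³` under `b`, and `x₃²` by `η⁶`; the product is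
  -- invariant of degree 11 and restricts to `x₀⁹x₁²`.
  let f : MvPolynomial (Fin 4) K := (MvPolynomial.X 0 ^ 9 +
    MvPolynomial.C (η ^ 6) * MvPolynomial.X 1 ^ 9 +
    MvPolynomial.C (η ^ 3) * MvPolynomial.X 2 ^ 9) * MvPolynomial.X 3 ^ 2
  have hf : f ∈ polyInvariants ψ := by
    refine mem_polyInvariants_of_generators (fun v => ?_) fun v => ?_
    · rw [(hψ v).1]
      have e4 : (η ^ 4) ^ 9 = 1 := by rw [← pow_mul, mul_comm, pow_mul, h9, one_pow]
      have e7 : (η ^ 7) ^ 9 = 1 := by rw [← pow_mul, mul_comm, pow_mul, h9, one_pow]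
      simp [f, mul_pow, h9, e4, e7]
    · rw [(hψ v).2]
      simp [f]
      linear_combination (v 2 ^ 9 * η ^ 3 * v 3 ^ 2 + v 0 ^ 9 * v 3 ^ 2) * h9
  rw [← hd] at hf
  have hmem := hle hf
  have hr : restrictToPlane K f = MvPolynomial.monomial
      (Finsupp.single 0 9 + Finsupp.single 1 2) 1 := by
    have : restrictToPlane K f = MvPolynomial.X 0 ^ 9 * MvPolynomial.X 1 ^ 2 := by
      simp [f, restrictToPlane]
    rw [this, MvPolynomial.X_pow_eq_monomial, MvPolynomial.X_pow_eq_monomial,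
      MvPolynomial.monomial_mul, one_mul]
  have := (hmem (Finsupp.single 0 9 + Finsupp.single 1 2) (by
    change MvPolynomial.coeff _ (restrictToPlane K f) ≠ 0
    rw [hr, MvPolynomial.coeff_monomial]; simp)).2.2
  simp at this

end Lower

/-! ### Linear forms. -/

section LinForm

variable {K : Type*} [Field K] {n : ℕ}

/-- The linear form with coefficient vector `y`. -/
noncomputable def linForm (y : Fin n → K) : MvPolynomial (Fin n) K :=
  ∑ j, MvPolynomial.C (y j) * MvPolynomial.X j

theorem eval_linForm (y v : Fin n → K) : MvPolynomial.eval v (linForm y) = y ⬝ᵥ v := by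
  simp [linForm, dotProduct]

theorem totalDegree_linForm_le (y : Fin n → K) : (linForm y).totalDegree ≤ 1 :=
  (MvPolynomial.IsHomogeneous.sum _ _ 1 fun _ _ =>
    MvPolynomial.isHomogeneous_C_mul_X _ _).totalDegree_le

theorem totalDegree_sub_C_le (p : MvPolynomial (Fin n) K) (c : K) :
    (p - MvPolynomial.C c).totalDegree ≤ p.totalDegree :=
  (MvPolynomial.totalDegree_sub _ _).trans (by simp)

theorem totalDegree_prod_le_card {ι : Type*} (s : Finset ι) (f : ι → MvPolynomial (Fin n) K)
    (hf : ∀ i ∈ s, (f i).totalDegree ≤ 1) : (∏ i ∈ s, f i).totalDegree ≤ s.card :=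
  (MvPolynomial.totalDegree_finsetProd _ _).trans
    ((Finset.sum_le_sum hf).trans (by simp))

/-- If `z` is not proportional to `u ≠ 0`, some linear functional kills `z` but not `u`. -/
theorem exists_dotProduct_eq_zero_ne_zero {u z : Fin n → K} (hu : u ≠ 0)
    (hz : ∀ t : K, z ≠ t • u) : ∃ y : Fin n → K, y ⬝ᵥ z = 0 ∧ y ⬝ᵥ u ≠ 0 := by
  by_contra! h
  obtain ⟨i, hi⟩ := Function.ne_iff.mp hu
  simp only [Pi.zero_apply] at hi
  refine hz (z i / u i) (funext fun j => ?_)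
  -- This functional kills `z`; if it also kills `u`, then `z j = (z i / u i) * u j`.
  have := h (z j • Pi.single i 1 - z i • Pi.single j 1) (by
    simp [sub_dotProduct, smul_dotProduct, mul_comm])
  simp only [sub_dotProduct, smul_dotProduct, single_one_dotProduct, smul_eq_mul] at this
  rw [Pi.smul_apply, smul_eq_mul]
  field_simp
  linear_combination this

end LinForm

/-! ### Polynomials vanishing on an orbit except at one point. -/

section Orbit

variable {K G : Type*} [Field K] [Group G] {n : ℕ} (ψ : G →* GL (Fin n) K)

/-- The stabilizer of the line spanned by `u`. -/
def lineStabilizer (u : Fin n → K) : Subgroup G where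
  carrier := {g | ∃ t : K, (ψ g : Matrix (Fin n) (Fin n) K) *ᵥ u = t • u}
  one_mem' := ⟨1, by simp⟩
  mul_mem' := by
    rintro g h ⟨s, hs⟩ ⟨t, ht⟩
    exact ⟨t * s, by
      rw [map_mul, Units.val_mul, ← Matrix.mulVec_mulVec, ht, Matrix.mulVec_smul, hs, smul_smul]⟩
  inv_mem' := by
    rintro g ⟨t, ht⟩
    refine ⟨t⁻¹, ?_⟩
    have h1 : u = t • ((ψ g⁻¹ : Matrix (Fin n) (Fin n) K) *ᵥ u) := by
      rw [← Matrix.mulVec_smul, ← ht, Matrix.mulVec_mulVec, ← Units.val_mul, ← map_mul]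
      simp
    by_cases h0 : t = 0
    · rw [h0, zero_smul] at h1
      rw [h1]; simp
    · conv_rhs => rw [h1]
      rw [inv_smul_smul₀ h0]

variable {ψ}

theorem mulVec_ne_zero_of_ne_zero {u : Fin n → K} (hu : u ≠ 0) (g : G) :
    (ψ g : Matrix (Fin n) (Fin n) K) *ᵥ u ≠ 0 := by
  intro h
  apply hu
  have : (ψ g⁻¹ : Matrix (Fin n) (Fin n) K) *ᵥ ((ψ g : Matrix (Fin n) (Fin n) K) *ᵥ u) = u := by
    rw [Matrix.mulVec_mulVec, ← Units.val_mul, ← map_mul]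
    simp
  rw [← this, h, Matrix.mulVec_zero]

theorem notMem_lineStabilizer {u y : Fin n → K} (hu : u ≠ 0) (hy : y ⬝ᵥ u ≠ 0) {g : G}
    (hg : y ⬝ᵥ ((ψ g : Matrix (Fin n) (Fin n) K) *ᵥ u) = 0) : g ∉ lineStabilizer ψ u := by
  rintro ⟨t, ht⟩
  rw [ht, dotProduct_smul, smul_eq_mul] at hg
  have := (mul_eq_zero.mp hg).resolve_right hy
  rw [this, zero_smul] at ht
  exact mulVec_ne_zero_of_ne_zero hu g ht

/-- The character by which the stabilizer of the line spanned by `u ≠ 0` acts on it. -/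
theorem exists_lineCharacter (ψ : G →* GL (Fin n) K) {u : Fin n → K} (hu : u ≠ 0) :
    ∃ χ : lineStabilizer ψ u →* Kˣ, ∀ g : lineStabilizer ψ u,
      (ψ g : Matrix (Fin n) (Fin n) K) *ᵥ u = (χ g : K) • u := by
  choose χ hχ using fun g : lineStabilizer ψ u => g.2
  have hinj : ∀ s t : K, s • u = t • u → s = t := fun s t h => smul_left_injective K hu h
  let χ' : lineStabilizer ψ u →* K :=
    { toFun := χ
      map_one' := hinj _ _ (by rw [← hχ]; simp)
      map_mul' := fun g h => hinj _ _ (by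
        rw [← hχ, Subgroup.coe_mul, map_mul, Units.val_mul, ← Matrix.mulVec_mulVec, hχ,
          Matrix.mulVec_smul, hχ, smul_smul, mul_comm]) }
  exact ⟨χ'.toHomUnits, hχ⟩

variable [Fintype G] [DecidableEq K]

/-- Given a linear form that vanishes on two nontrivial translates of the line `K u` but not
on `u`, there is a polynomial of small degree that vanishes on the orbit of `u` except at `u`. -/
theorem exists_vanishing_on_orbit (ψ : G →* GL (Fin n) K) {u : Fin n → K} (hu : u ≠ 0)
    {y : Fin n → K} (hy : y ⬝ᵥ u ≠ 0) {g₁ g₂ : G}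
    (h₁ : y ⬝ᵥ ((ψ g₁ : Matrix (Fin n) (Fin n) K) *ᵥ u) = 0)
    (h₂ : y ⬝ᵥ ((ψ g₂ : Matrix (Fin n) (Fin n) K) *ᵥ u) = 0)
    (h₁₂ : g₁⁻¹ * g₂ ∉ lineStabilizer ψ u) :
    ∃ (f : MvPolynomial (Fin n) K) (T : Finset K) (q : ℕ),
      f.totalDegree + 3 ≤ q + T.card ∧ 3 ≤ q ∧
      q * T.card * (Finset.univ.filter fun g : G =>
        (ψ g : Matrix (Fin n) (Fin n) K) *ᵥ u = u).card = Fintype.card G ∧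
      (∀ (g : G) (t : K), (ψ g : Matrix (Fin n) (Fin n) K) *ᵥ u = t • u → t ∈ T) ∧
      MvPolynomial.eval u f ≠ 0 ∧
      ∀ g : G, (ψ g : Matrix (Fin n) (Fin n) K) *ᵥ u ≠ u →
        MvPolynomial.eval ((ψ g : Matrix (Fin n) (Fin n) K) *ᵥ u) f = 0 := by
  classical
  set P := lineStabilizer ψ u with hP
  have hmemP : ∀ g, g ∈ P ↔ ∃ t : K, (ψ g : Matrix (Fin n) (Fin n) K) *ᵥ u = t • u :=
    fun g => Iff.rfl
  obtain ⟨χ, hχ⟩ : ∃ χ : P →* Kˣ, ∀ g : P,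
      (ψ g : Matrix (Fin n) (Fin n) K) *ᵥ u = (χ g : K) • u := exists_lineCharacter ψ hu
  have hinj : ∀ s t : K, s • u = t • u → s = t := fun s t h => smul_left_injective K hu h
  let T : Finset K := Finset.univ.image fun p : P => (χ p : K)
  have hT : ∀ (g : G) (t : K), (ψ g : Matrix (Fin n) (Fin n) K) *ᵥ u = t • u → t ∈ T := by
    intro g t h
    refine Finset.mem_image.mpr ⟨⟨g, (hmemP g).mpr ⟨t, h⟩⟩, Finset.mem_univ _, hinj _ _ ?_⟩
    rw [← hχ, ← h]
  have hTcard : T.card = Nat.card χ.range := by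
    have h1 : T = (Finset.univ.image χ).image Units.val := by
      rw [Finset.image_image]; rfl
    have h2 : ((Finset.univ.image χ : Finset Kˣ) : Set Kˣ) = χ.range := by simp
    rw [h1, Finset.card_image_of_injective _ Units.val_injective, ← Set.ncard_coe_finset, h2]
    rfl
  have hker : (Finset.univ.filter fun g : G =>
      (ψ g : Matrix (Fin n) (Fin n) K) *ᵥ u = u).card = Nat.card χ.ker := by
    rw [← Fintype.card_coe, ← Nat.card_eq_fintype_card]
    have h1 : ∀ p : P, χ p = 1 ↔ (ψ p : Matrix (Fin n) (Fin n) K) *ᵥ u = u := fun p => by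
      rw [hχ, ← Units.val_eq_one]
      exact ⟨fun h => by rw [h, one_smul], fun h => hinj _ _ (by rw [h, one_smul])⟩
    refine Nat.card_congr
      { toFun := fun g => ⟨⟨g, (hmemP g).mpr ⟨1, ?_⟩⟩, ?_⟩
        invFun := fun p => ⟨p.1, ?_⟩
        left_inv := fun g => rfl
        right_inv := fun p => rfl }
    · rw [one_smul]; exact (Finset.mem_filter.mp g.2).2
    · exact (h1 _).mpr (Finset.mem_filter.mp g.2).2
    · exact Finset.mem_filter.mpr ⟨Finset.mem_univ _, (h1 _).mp p.2⟩
  -- The orbit of `u` meets `|G ⧸ P|` lines, each in `T.card` points, and the stabilizer of `u` is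
  -- the kernel of `χ`.
  have hcard : Nat.card (G ⧸ P) * T.card * (Finset.univ.filter fun g : G =>
      (ψ g : Matrix (Fin n) (Fin n) K) *ᵥ u = u).card = Fintype.card G := by
    rw [hTcard, hker, mul_assoc, ← Subgroup.index_ker, mul_comm (Subgroup.index _),
      Subgroup.card_mul_index, ← Nat.card_eq_fintype_card, Subgroup.card_eq_card_quotient_mul_card_subgroup P]
  have hcoset : ∀ (g h : G) (z : Fin n → K), (g : G ⧸ P) = h →
      z ⬝ᵥ ((ψ g : Matrix (Fin n) (Fin n) K) *ᵥ u) = 0 →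
      z ⬝ᵥ ((ψ h : Matrix (Fin n) (Fin n) K) *ᵥ u) = 0 := by
    intro g h z hgh hz
    obtain ⟨t, ht⟩ := QuotientGroup.eq.mp hgh
    have : h = g * (g⁻¹ * h) := by group
    rw [this, map_mul, Units.val_mul, ← Matrix.mulVec_mulVec, ht, Matrix.mulVec_smul,
      dotProduct_smul, hz, smul_zero]
  have hmk : ∀ g : G, g ∉ P → (g : G ⧸ P) ≠ ((1 : G) : G ⧸ P) := by
    intro g hg h
    exact hg (by simpa using QuotientGroup.eq.mp h.symm)
  have hline : ∀ q : G ⧸ P, ∃ z : Fin n → K, q ≠ ((1 : G) : G ⧸ P) →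
      z ⬝ᵥ u ≠ 0 ∧ ∀ g : G, (g : G ⧸ P) = q →
        z ⬝ᵥ ((ψ g : Matrix (Fin n) (Fin n) K) *ᵥ u) = 0 := by
    intro q
    obtain ⟨h, rfl⟩ := QuotientGroup.mk_surjective q
    by_cases hh : h ∈ P
    · exact ⟨0, fun hne => absurd (QuotientGroup.eq.mpr (by simpa using P.inv_mem hh)) hne⟩
    · obtain ⟨z, hz1, hz2⟩ := exists_dotProduct_eq_zero_ne_zero hu fun t ht => hh ⟨t, ht⟩
      exact ⟨z, fun _ => ⟨hz2, fun g hg => hcoset h g z hg.symm hz1⟩⟩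
  choose z hz using hline
  have n₁ := hmk g₁ (notMem_lineStabilizer hu hy h₁)
  have n₂ := hmk g₂ (notMem_lineStabilizer hu hy h₂)
  have n₁₂ : (g₁ : G ⧸ P) ≠ g₂ := fun h => h₁₂ (QuotientGroup.eq.mp h)
  let Q : Finset (G ⧸ P) := Finset.univ \ {((1 : G) : G ⧸ P), (g₁ : G ⧸ P), (g₂ : G ⧸ P)}
  have hthree : ({((1 : G) : G ⧸ P), (g₁ : G ⧸ P), (g₂ : G ⧸ P)} : Finset (G ⧸ P)).card = 3 :=
    Finset.card_eq_three.mpr ⟨_, _, _, n₁.symm, n₂.symm, n₁₂, rfl⟩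
  have hQ : Q.card + 3 = Nat.card (G ⧸ P) := by
    rw [← hthree, Finset.card_sdiff_add_card_eq_card (Finset.subset_univ _), Finset.card_univ,
      Nat.card_eq_fintype_card]
  have h1T : (1 : K) ∈ T := hT 1 1 (by simp)
  -- One form `y` serves the two lines of `g₁` and `g₂`, each further line other than `K u` takes
  -- one form, and each other orbit point on `K u` takes one translate of `y`: with `q` lines the
  -- degree is at most `1 + (q - 3) + (T.card - 1)`.
  refine ⟨linForm y * (∏ q ∈ Q, linForm (z q)) *
    ∏ t ∈ T.erase 1, (linForm y - MvPolynomial.C (t * (y ⬝ᵥ u))), T, Nat.card (G ⧸ P), ?_,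
    by omega, hcard, hT, ?_, ?_⟩
  · have d1 := totalDegree_linForm_le y
    have d2 := totalDegree_prod_le_card Q (fun q => linForm (z q))
      fun q _ => totalDegree_linForm_le _
    have d3 := totalDegree_prod_le_card (T.erase 1)
      (fun t => linForm y - MvPolynomial.C (t * (y ⬝ᵥ u)))
      fun t _ => (totalDegree_sub_C_le _ _).trans d1
    have d4 := Finset.card_erase_add_one h1T
    have d5 := MvPolynomial.totalDegree_mul (linForm y * (∏ q ∈ Q, linForm (z q)))
      (∏ t ∈ T.erase 1, (linForm y - MvPolynomial.C (t * (y ⬝ᵥ u))))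
    have d6 := MvPolynomial.totalDegree_mul (linForm y) (∏ q ∈ Q, linForm (z q))
    omega
  · simp only [map_mul, map_prod, map_sub, MvPolynomial.eval_C, eval_linForm]
    refine mul_ne_zero (mul_ne_zero hy ?_) ?_
    · refine Finset.prod_ne_zero_iff.mpr fun q hq => (hz q fun h => ?_).1
      simp [Q, h] at hq
    · refine Finset.prod_ne_zero_iff.mpr fun t ht => ?_
      have : y ⬝ᵥ u - t * (y ⬝ᵥ u) = (1 - t) * (y ⬝ᵥ u) := by ring
      rw [this]
      exact mul_ne_zero (sub_ne_zero.mpr (Finset.ne_of_mem_erase ht).symm) hy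
  · intro g hg
    simp only [map_mul, map_prod, map_sub, MvPolynomial.eval_C, eval_linForm]
    by_cases hgP : g ∈ P
    · obtain ⟨t, ht⟩ := hgP
      refine mul_eq_zero_of_right _ (Finset.prod_eq_zero (i := t) ?_ ?_)
      · refine Finset.mem_erase.mpr ⟨fun h => hg ?_, hT g t ht⟩
        rw [ht, h, one_smul]
      · rw [ht, dotProduct_smul, smul_eq_mul, sub_self]
    · refine mul_eq_zero_of_left ?_ _
      by_cases hgQ : (g : G ⧸ P) ∈ Q
      · refine mul_eq_zero_of_right _ (Finset.prod_eq_zero hgQ ?_)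
        exact (hz _ (hmk g hgP)).2 g rfl
      · refine mul_eq_zero_of_left ?_ _
        have : (g : G ⧸ P) = g₁ ∨ (g : G ⧸ P) = g₂ := by
          simp only [Q, Finset.mem_sdiff, Finset.mem_univ, true_and, not_not,
            Finset.mem_insert, Finset.mem_singleton] at hgQ
          exact hgQ.resolve_left (hmk g hgP)
        rcases this with h | h
        · exact hcoset _ _ _ h.symm h₁
        · exact hcoset _ _ _ h.symm h₂

end Orbit

/-! ### Generic functionals and orbit polynomials. -/

section Separation

variable {K G : Type*} [Field K] [Group G] {n : ℕ}

theorem mulVec_map_mul (ψ : G →* GL (Fin n) K) (g h : G) (v : Fin n → K) :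
    (ψ (g * h) : Matrix (Fin n) (Fin n) K) *ᵥ v =
      (ψ g : Matrix (Fin n) (Fin n) K) *ᵥ ((ψ h : Matrix (Fin n) (Fin n) K) *ᵥ v) := by
  rw [map_mul, Units.val_mul, Matrix.mulVec_mulVec]

theorem vecOrbit_mulVec (ψ : G →* GL (Fin n) K) (g : G) (v : Fin n → K) :
    vecOrbit ψ ((ψ g : Matrix (Fin n) (Fin n) K) *ᵥ v) = vecOrbit ψ v := by
  refine Set.Subset.antisymm ?_ ?_
  · rintro _ ⟨h, rfl⟩
    exact ⟨h * g, mulVec_map_mul ψ h g v⟩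
  · rintro _ ⟨h, rfl⟩
    refine ⟨h * g⁻¹, ?_⟩
    simp only
    rw [← mulVec_map_mul, inv_mul_cancel_right]

/-- Over an infinite field finitely many hyperplanes do not cover the space: the product of their
equations is a nonzero polynomial. -/
theorem exists_dotProduct_ne_zero [Infinite K] {ι : Type*} [Finite ι] (z : ι → Fin n → K)
    (hz : ∀ i, z i ≠ 0) : ∃ y : Fin n → K, ∀ i, y ⬝ᵥ z i ≠ 0 := by
  have := Fintype.ofFinite ι
  have hne : (∏ i, linForm (z i)) ≠ 0 := Finset.prod_ne_zero_iff.mpr fun i _ h => by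
    obtain ⟨j, hj⟩ := Function.ne_iff.mp (hz i)
    apply hj
    have := eval_linForm (z i) (Pi.single j 1)
    rw [h, map_zero, dotProduct_single_one] at this
    exact this.symm
  by_contra! h
  refine hne (MvPolynomial.funext fun y => ?_)
  obtain ⟨i, hi⟩ := h y
  rw [map_prod, map_zero]
  exact Finset.prod_eq_zero (Finset.mem_univ i) (by rw [eval_linForm, dotProduct_comm, hi])

/-- The orbit polynomial of a linear functional under a subgroup `S`. -/
theorem exists_orbit_polynomial [DecidableEq K] (ψ : G →* GL (Fin n) K) (S : Finset G)
    (h1 : 1 ∈ S)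
    (hS : ∀ s ∈ S, ∀ t ∈ S, s * t ∈ S) (y v w : Fin n → K)
    (hy : ∀ s ∈ S, y ⬝ᵥ ((ψ s : Matrix (Fin n) (Fin n) K) *ᵥ v) ≠ y ⬝ᵥ w) :
    ∃ f : MvPolynomial (Fin n) K,
      f.totalDegree ≤ (S.image fun s => y ᵥ* (ψ s : Matrix (Fin n) (Fin n) K)).card ∧
      (∀ s ∈ S, ∀ x, MvPolynomial.eval ((ψ s : Matrix (Fin n) (Fin n) K) *ᵥ x) f =
        MvPolynomial.eval x f) ∧
      MvPolynomial.eval w f = 0 ∧ MvPolynomial.eval v f ≠ 0 := by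
  set L := S.image fun s => y ᵥ* (ψ s : Matrix (Fin n) (Fin n) K) with hL
  refine ⟨∏ r ∈ L, (linForm r - MvPolynomial.C (y ⬝ᵥ w)), totalDegree_prod_le_card _ _
    fun r _ => (totalDegree_sub_C_le _ _).trans (totalDegree_linForm_le r), ?_, ?_, ?_⟩
  · intro s hs x
    simp only [map_prod, map_sub, MvPolynomial.eval_C, eval_linForm]
    -- Right multiplication by `s` permutes the finite set of translates of `y`, which makes the
    -- product invariant.
    have hmaps : ∀ r ∈ L, r ᵥ* (ψ s : Matrix (Fin n) (Fin n) K) ∈ L := by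
      intro r hr
      obtain ⟨t, ht, rfl⟩ := Finset.mem_image.mp hr
      refine Finset.mem_image.mpr ⟨t * s, hS t ht s hs, ?_⟩
      rw [map_mul, Units.val_mul, Matrix.vecMul_vecMul]
    have hinj : Set.InjOn (fun r => r ᵥ* (ψ s : Matrix (Fin n) (Fin n) K)) L := by
      intro r _ r' _ h
      have := congrArg (fun r => r ᵥ* (ψ s⁻¹ : Matrix (Fin n) (Fin n) K)) h
      simpa only [Matrix.vecMul_vecMul, ← Units.val_mul, ← map_mul, mul_inv_cancel, map_one,
        Units.val_one, Matrix.vecMul_one] using this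
    refine Finset.prod_bij (fun r _ => r ᵥ* (ψ s : Matrix (Fin n) (Fin n) K)) hmaps
      (fun r hr r' hr' h => hinj hr hr' h)
      (fun r hr => ?_) fun r _ => by rw [Matrix.dotProduct_mulVec]
    obtain ⟨r', hr', h⟩ := Finset.surjOn_of_injOn_of_card_le _ hmaps hinj le_rfl hr
    exact ⟨r', hr', h⟩
  · rw [map_prod]
    refine Finset.prod_eq_zero (i := y) (Finset.mem_image.mpr ⟨1, h1, by simp⟩) ?_
    rw [map_sub, MvPolynomial.eval_C, eval_linForm, sub_self]
  · rw [map_prod]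
    refine Finset.prod_ne_zero_iff.mpr fun r hr => ?_
    obtain ⟨t, ht, rfl⟩ := Finset.mem_image.mp hr
    rw [map_sub, MvPolynomial.eval_C, eval_linForm, ← Matrix.dotProduct_mulVec]
    exact sub_ne_zero.mpr (hy t ht)

end Separation

/-! ### The faithful 3-dimensional representations. -/

section Three

variable {K : Type*} [Field K] [CharZero K] {η : K}

/-- A linear form killing two translated lines at once saves enough degree to leave room for an
orbit polynomial of the stabilizer within total degree 10. -/
theorem exists_vanishing_on_orbit_three [DecidableEq K] (hη : IsPrimitiveRoot η 9)
    {ψ : M27 →* GL (Fin 3) K}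
    (hψ : ∀ x : Fin 3 → K,
      (ψ M27.a : Matrix (Fin 3) (Fin 3) K) *ᵥ x = ![η * x 0, η ^ 4 * x 1, η ^ 7 * x 2] ∧
      (ψ M27.b : Matrix (Fin 3) (Fin 3) K) *ᵥ x = ![x 1, x 2, x 0])
    {u : Fin 3 → K} (hu : u ≠ 0) :
    ∃ f : MvPolynomial (Fin 3) K,
      f.totalDegree + (Finset.univ.filter fun g : M27 =>
        (ψ g : Matrix (Fin 3) (Fin 3) K) *ᵥ u = u).card ≤ 10 ∧
      MvPolynomial.eval u f ≠ 0 ∧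
      ∀ g : M27, (ψ g : Matrix (Fin 3) (Fin 3) K) *ᵥ u ≠ u →
        MvPolynomial.eval ((ψ g : Matrix (Fin 3) (Fin 3) K) *ᵥ u) f = 0 := by
  have h9 : η ^ 9 = 1 := hη.pow_eq_one
  have hη0 : η ≠ 0 := hη.ne_zero (by norm_num)
  have h3 : η ^ 3 ≠ 1 := hη.pow_ne_one_of_pos_of_lt (by norm_num) (by norm_num)
  have hs : 1 + η ^ 3 + η ^ 6 = 0 := by
    have : (η ^ 3 - 1) * (1 + η ^ 3 + η ^ 6) = 0 := by linear_combination h9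
    exact (mul_eq_zero.mp this).resolve_left (sub_ne_zero.mpr h3)
  have hb : ∀ (x : Fin 3 → K) (i : Fin 3),
      ((ψ M27.b : Matrix (Fin 3) (Fin 3) K) *ᵥ x) i = x (i + 1) := by
    intro x i
    rw [(hψ x).2]
    fin_cases i <;> rfl
  have ha : ∀ (x : Fin 3 → K) (i : Fin 3),
      ((ψ M27.a : Matrix (Fin 3) (Fin 3) K) *ᵥ x) i = ![η, η ^ 4, η ^ 7] i * x i := by
    intro x i
    rw [(hψ x).1]
    fin_cases i <;> rfl
  have hlam : ∀ i : Fin 3, ![η, η ^ 4, η ^ 7] i ≠ ![η, η ^ 4, η ^ 7] (i + 2) := by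
    have h47 : η ^ 4 ≠ η := fun h => h3 (mul_left_cancel₀ hη0 (by linear_combination h))
    have h17 : η ≠ η ^ 7 := fun h => by
      have h6 : η ^ 6 = 1 := mul_left_cancel₀ hη0 (by linear_combination -h)
      exact hη.pow_ne_one_of_pos_of_lt (by norm_num) (by norm_num) h6
    have h74 : η ^ 7 ≠ η ^ 4 := fun h =>
      h3 (mul_left_cancel₀ (pow_ne_zero 4 hη0) (by linear_combination h))
    intro i
    fin_cases i
    · exact h17
    · exact h47
    · exact h74
  obtain ⟨y, g₁, g₂, hy, h₁, h₂, h₁₂⟩ : ∃ (y : Fin 3 → K) (g₁ g₂ : M27), y ⬝ᵥ u ≠ 0 ∧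
      y ⬝ᵥ ((ψ g₁ : Matrix (Fin 3) (Fin 3) K) *ᵥ u) = 0 ∧
      y ⬝ᵥ ((ψ g₂ : Matrix (Fin 3) (Fin 3) K) *ᵥ u) = 0 ∧
      g₁⁻¹ * g₂ ∉ lineStabilizer ψ u := by
    by_cases hnz : ∀ i, u i ≠ 0
    · have e0 := hnz 0
      have e1 := hnz 1
      have e2 := hnz 2
      -- The value of this form at `u` is 3; at `a u` and `a² u` it is a multiple of a sum of all
      -- cube roots of unity, hence 0.
      have hy : ![(u 0)⁻¹, (u 1)⁻¹, (u 2)⁻¹] ⬝ᵥ u ≠ 0 := by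
        simp [dotProduct, Fin.sum_univ_three, e0, e1, e2]
        norm_num
      have hya : ![(u 0)⁻¹, (u 1)⁻¹, (u 2)⁻¹] ⬝ᵥ
          ((ψ M27.a : Matrix (Fin 3) (Fin 3) K) *ᵥ u) = 0 := by
        rw [(hψ u).1]
        simp [dotProduct, Fin.sum_univ_three]
        field_simp
        linear_combination η * hs
      refine ⟨_, M27.a, M27.a ^ 2, hy, hya, ?_, ?_⟩
      · rw [pow_two, mulVec_map_mul, (hψ _).1, (hψ u).1]
        simp [dotProduct, Fin.sum_univ_three]
        field_simp
        linear_combination η ^ 2 * hs + η ^ 5 * h9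
      · rw [pow_two, inv_mul_cancel_left]
        exact notMem_lineStabilizer hu hy hya
    · push Not at hnz
      obtain ⟨i, hi, hi1⟩ : ∃ i, u i ≠ 0 ∧ u (i + 1) = 0 := by
        by_contra! hcon
        obtain ⟨j, hj⟩ := hnz
        apply hu
        have hstep : ∀ i : Fin 3, u (i + 1) = 0 → u i = 0 := fun i hi => by
          by_contra h
          exact hcon i h hi
        have hj2 : u (j + 2) = 0 := hstep _ (by rwa [show j + 2 + 1 = j by omega])
        have hj1 : u (j + 1) = 0 := hstep _ (by rwa [show j + 1 + 1 = j + 2 by omega])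
        funext k
        have : k = j ∨ k = j + 1 ∨ k = j + 2 := by omega
        rcases this with rfl | rfl | rfl <;> assumption
      have hy : Pi.single i (1 : K) ⬝ᵥ u ≠ 0 := by rwa [single_one_dotProduct]
      have hyb : Pi.single i (1 : K) ⬝ᵥ ((ψ M27.b : Matrix (Fin 3) (Fin 3) K) *ᵥ u) = 0 := by
        rw [single_one_dotProduct, hb, hi1]
      -- If `a` fixes the line, then `u` has a single nonzero coordinate, and `b` and `b²` move it
      -- away from `i`. Otherwise `b u` and `b a u` both have coordinate `i` zero and span different
      -- lines.
      by_cases hP : M27.a ∈ lineStabilizer ψ u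
      · obtain ⟨t, ht⟩ := hP
        have hi2 : u (i + 2) = 0 := by
          have e1 := congrFun ht i
          have e2 := congrFun ht (i + 2)
          rw [ha, Pi.smul_apply, smul_eq_mul] at e1 e2
          have e3 := mul_right_cancel₀ hi e1
          rw [← e3] at e2
          have e4 : (![η, η ^ 4, η ^ 7] i - ![η, η ^ 4, η ^ 7] (i + 2)) * u (i + 2) = 0 := by
            linear_combination -e2
          exact (mul_eq_zero.mp e4).resolve_left (sub_ne_zero.mpr (hlam i))
        refine ⟨Pi.single i 1, M27.b, M27.b ^ 2, hy, hyb, ?_, ?_⟩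
        · rw [pow_two, mulVec_map_mul, single_one_dotProduct, hb, hb,
            show i + 1 + 1 = i + 2 by omega, hi2]
        · rw [pow_two, inv_mul_cancel_left]
          exact notMem_lineStabilizer hu hy hyb
      · refine ⟨Pi.single i 1, M27.b, M27.b * M27.a, hy, hyb, ?_, ?_⟩
        · rw [mulVec_map_mul, single_one_dotProduct, hb, ha, hi1, mul_zero]
        · rwa [inv_mul_cancel_left]
  obtain ⟨f, T, q, hdeg, hq, hcard, hT, hfu, hfg⟩ := exists_vanishing_on_orbit ψ hu hy h₁ h₂ h₁₂
  refine ⟨f, ?_, hfu, hfg⟩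
  have hc : (ψ (M27.a ^ 3) : Matrix (Fin 3) (Fin 3) K) *ᵥ u = η ^ 3 • u := by
    rw [pow_succ, pow_two, mulVec_map_mul, mulVec_map_mul]
    funext i
    simp only [ha, Pi.smul_apply, smul_eq_mul]
    fin_cases i
    · simp; ring
    · simp; linear_combination (u 1 * η ^ 3) * h9
    · simp; linear_combination (u 2 * (η ^ 12 + η ^ 3)) * h9
  have m0 : (1 : K) ∈ T := hT 1 1 (by simp)
  have m1 : η ^ 3 ∈ T := hT _ _ hc
  have m2 : η ^ 6 ∈ T := hT (M27.a ^ 3 * M27.a ^ 3) _ (by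
    rw [mulVec_map_mul, hc, Matrix.mulVec_smul, hc, smul_smul]
    ring_nf)
  -- The central element `a³` acts as `η³`, so the scalars `1, η³, η⁶` all occur.
  have hT3 : 3 ≤ T.card := by
    have h6 : η ^ 6 ≠ 1 := hη.pow_ne_one_of_pos_of_lt (by norm_num) (by norm_num)
    have h36 : η ^ 3 ≠ η ^ 6 := fun h =>
      h3 (mul_left_cancel₀ (pow_ne_zero 3 hη0) (by linear_combination -h))
    rw [← Finset.card_eq_three.mpr ⟨1, η ^ 3, η ^ 6, h3.symm, h6.symm, h36, rfl⟩]
    refine Finset.card_le_card fun t ht => ?_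
    simp only [Finset.mem_insert, Finset.mem_singleton] at ht
    rcases ht with rfl | rfl | rfl <;> assumption
  rw [M27.card] at hcard
  revert hcard hdeg
  generalize (Finset.univ.filter fun g : M27 =>
    (ψ g : Matrix (Fin 3) (Fin 3) K) *ᵥ u = u).card = k
  generalize T.card = t at *
  intro hdeg hcard
  -- Here `q * t * k = 27` with `q, t ≥ 3`, so `(q, t, k)` is `(9,3,1)`, `(3,9,1)` or `(3,3,3)`.
  have key : q + t + k ≤ 13 := by
    have hqd : q ∣ 3 ^ 3 := ⟨t * k, by rw [← mul_assoc, hcard]; norm_num⟩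
    have htd : t ∣ 3 ^ 3 := ⟨q * k, by rw [← mul_assoc, mul_comm t q, hcard]; norm_num⟩
    obtain ⟨i, hi, rfl⟩ := (Nat.dvd_prime_pow Nat.prime_three).mp hqd
    obtain ⟨j, hj, rfl⟩ := (Nat.dvd_prime_pow Nat.prime_three).mp htd
    interval_cases i <;> interval_cases j <;> simp_all <;> omega
  omega

/-- As `a³` acts by the scalar `η³`, every monomial of an invariant has degree divisible by 3, which
rules out 10 and 11. -/
theorem totalDegree_le_nine_of_mem (hη : IsPrimitiveRoot η 9)
    {ψ : M27 →* GL (Fin 3) K}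
    (hψ : ∀ x : Fin 3 → K,
      (ψ M27.a : Matrix (Fin 3) (Fin 3) K) *ᵥ x = ![η * x 0, η ^ 4 * x 1, η ^ 7 * x 2] ∧
      (ψ M27.b : Matrix (Fin 3) (Fin 3) K) *ᵥ x = ![x 1, x 2, x 0])
    {f : MvPolynomial (Fin 3) K} (hf : f ∈ invariantsOfDegreeLE ψ 11) : f.totalDegree ≤ 9 := by
  have h9 : η ^ 9 = 1 := hη.pow_eq_one
  obtain ⟨hinv, hdeg⟩ := hf
  rw [mem_polyInvariants_iff_eval] at hinv
  refine Finset.sup_le fun m hm => ?_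
  have hle := (MvPolynomial.le_totalDegree hm).trans hdeg
  have h := prod_pow_mul_coeff_eq_of_eval_eq (fun _ => η ^ 3) (fun _ => 1) f (fun v => by
    rw [← hinv (M27.a ^ 3) ((fun _ => 1) * v)]
    congr 1
    congr 1
    rw [show M27.a ^ 3 = M27.a * M27.a * M27.a by decide, mulVec_map_mul, mulVec_map_mul, (hψ _).1, (hψ _).1, (hψ _).1]
    funext i
    fin_cases i
    · simp; ring
    · simp; linear_combination (-v 1 * η ^ 3) * h9
    · simp; linear_combination (-v 2 * (η ^ 12 + η ^ 3)) * h9) m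
  have h := mul_right_cancel₀ (MvPolynomial.mem_support_iff.mp hm) h
  rw [Finset.prod_pow_eq_pow_sum, ← pow_mul] at h
  simp only [one_pow, Finset.prod_const_one] at h
  have hd := (hη.pow_eq_one_iff_dvd _).mp h
  rw [Finsupp.sum_fintype _ _ (by simp)] at hle ⊢
  omega

/-- An orbit polynomial of the whole group separates two distinct orbits, and it lies in the algebra
generated in degree at most 11, hence in that generated in degree at most 9. -/
theorem exists_eq_mulVec_of_eval_eq_three (hη : IsPrimitiveRoot η 9)
    {ψ : M27 →* GL (Fin 3) K}
    (hψ : ∀ x : Fin 3 → K,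
      (ψ M27.a : Matrix (Fin 3) (Fin 3) K) *ᵥ x = ![η * x 0, η ^ 4 * x 1, η ^ 7 * x 2] ∧
      (ψ M27.b : Matrix (Fin 3) (Fin 3) K) *ᵥ x = ![x 1, x 2, x 0])
    {u u' : Fin 3 → K}
    (h : ∀ f ∈ invariantsOfDegreeLE ψ 9, MvPolynomial.eval u f = MvPolynomial.eval u' f) :
    ∃ g : M27, (ψ g : Matrix (Fin 3) (Fin 3) K) *ᵥ u = u' := by
  classical
  by_contra! hne
  have hζ : IsPrimitiveRoot (η ^ 3) 3 := hη.pow (by norm_num) (by norm_num)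
  obtain ⟨y, hy⟩ := exists_dotProduct_ne_zero
    (fun g : M27 => (ψ g : Matrix (Fin 3) (Fin 3) K) *ᵥ u - u') fun g => sub_ne_zero.mpr (hne g)
  obtain ⟨f, -, hf, hf0, hfne⟩ := exists_orbit_polynomial ψ Finset.univ (Finset.mem_univ _)
    (fun _ _ _ _ => Finset.mem_univ _) y u u' fun g _ => by
      have := hy g
      rwa [dotProduct_sub, sub_ne_zero] at this
  have hinv : f ∈ polyInvariants ψ :=
    (mem_polyInvariants_iff_eval ψ).mpr fun g x => hf g (Finset.mem_univ _) x
  rw [← adjoin_invariantsOfDegreeLE_eleven ψ hζ] at hinv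
  have hle : Algebra.adjoin K (invariantsOfDegreeLE ψ 11) ≤
      AlgHom.equalizer (MvPolynomial.aeval u : MvPolynomial (Fin 3) K →ₐ[K] K)
        (MvPolynomial.aeval u') := by
    refine Algebra.adjoin_le fun p hp => ?_
    change MvPolynomial.aeval u p = MvPolynomial.aeval u' p
    simp only [MvPolynomial.aeval_eq_eval]
    exact h p ⟨hp.1, totalDegree_le_nine_of_mem hη hψ hp⟩
  have := hle hinv
  change MvPolynomial.aeval u f = MvPolynomial.aeval u' f at this
  simp only [MvPolynomial.aeval_eq_eval] at this
  exact hfne (this.trans hf0)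

end Three

theorem M27.mul_cube_comm (g : M27) : g * M27.a ^ 3 = M27.a ^ 3 * g := by
  have h : ∀ (x : ZMod 9) (y : ZMod 3),
      (⟨.ofAdd x, .ofAdd y⟩ : M27) * M27.a ^ 3 = M27.a ^ 3 * ⟨.ofAdd x, .ofAdd y⟩ := by decide
  exact h g.left.toAdd g.right.toAdd

/-! ### Separation in degree 10. -/

section Separating

variable {K : Type*} [Field K] [CharZero K] {η : K} {n : ℕ}

/-- The row vectors are spanned by eigenvectors of a matrix of order dividing `9`. -/
theorem span_eigenrows_eq_top (hη : IsPrimitiveRoot η 9) {A : Matrix (Fin n) (Fin n) K}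
    (hA : A ^ 9 = 1) : Submodule.span K {q : Fin n → K | ∃ k : ℕ, q ᵥ* A = η ^ k • q} = ⊤ := by
  have hζ : IsPrimitiveRoot (η ^ 3) 3 := hη.pow (by norm_num) (by norm_num)
  have h9 : ∀ k, η ^ (9 * k) = 1 := fun k => by rw [pow_mul, hη.pow_eq_one, one_pow]
  have hcube : ∀ r : Fin n → K, r ᵥ* A ᵥ* A ᵥ* A = r ᵥ* A ^ 3 := fun r => by
    rw [Matrix.vecMul_vecMul, Matrix.vecMul_vecMul, pow_succ, pow_two, mul_assoc]
  rw [eq_top_iff]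
  intro y _
  have h1 := mem_span_eigenvectors_of_cube hζ (Matrix.vecMulLinear (A ^ 3)) ⊤ (fun p _ => by
    simp only [Matrix.vecMulLinear_apply, Matrix.vecMul_vecMul]
    rw [← pow_add, ← pow_add, hA, Matrix.vecMul_one]) (fun _ _ => Submodule.mem_top)
    (Submodule.mem_top (x := y))
  refine Submodule.span_le.mpr ?_ h1
  rintro q ⟨-, i, hi⟩
  rw [Matrix.vecMulLinear_apply, ← pow_mul] at hi
  let N : Submodule K (Fin n → K) :=
    LinearMap.ker (Matrix.vecMulLinear (A ^ 3) - η ^ (3 * i.val) • LinearMap.id)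
  have hN : ∀ r, r ∈ N ↔ r ᵥ* A ^ 3 = η ^ (3 * i.val) • r := fun r => by
    rw [LinearMap.mem_ker]
    simp [sub_eq_zero]
  -- On the eigenspace where `A³` is `η^(3i)`, the rescaled map `η^(-i) A`, with `-i` written as
  -- `8i`, has cube 1.
  have h2 := mem_span_eigenvectors_of_cube hζ (η ^ (8 * i.val) • Matrix.vecMulLinear A) N
    (fun r hr => by
      simp only [LinearMap.smul_apply, Matrix.vecMulLinear_apply, Matrix.smul_vecMul, smul_smul]
      rw [hcube, (hN r).mp hr, smul_smul, ← pow_add, ← pow_add, ← pow_add,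
        show 8 * i.val + (8 * i.val + 8 * i.val) + 3 * i.val = 9 * (3 * i.val) by ring, h9, one_smul])
    (fun r hr => by
      rw [hN] at hr ⊢
      simp only [LinearMap.smul_apply, Matrix.vecMulLinear_apply, Matrix.smul_vecMul]
      rw [Matrix.vecMul_vecMul, ← pow_succ', pow_succ, ← Matrix.vecMul_vecMul, hr,
        Matrix.smul_vecMul, smul_comm])
    ((hN q).mpr hi)
  refine Submodule.span_mono ?_ h2
  rintro r ⟨-, j, hj⟩
  refine ⟨i.val + 3 * j.val, ?_⟩
  have := congrArg (fun z => η ^ i.val • z) hj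
  simp only [LinearMap.smul_apply, Matrix.vecMulLinear_apply, smul_smul] at this
  rwa [← pow_add, show i.val + 8 * i.val = 9 * i.val by ring, h9, one_smul, ← pow_mul,
    ← pow_add] at this

/-- A vector not fixed by the center has nonzero image under an equivariant linear map to a
faithful irreducible representation. -/
theorem exists_equivariant_three (hη : IsPrimitiveRoot η 9) (ψ : M27 →* GL (Fin n) K)
    {v : Fin n → K} (hv : (ψ (M27.a ^ 3) : Matrix (Fin n) (Fin n) K) *ᵥ v ≠ v) :
    ∃ (θ : K) (_ : IsPrimitiveRoot θ 9) (φ : M27 →* GL (Fin 3) K) (M : Matrix (Fin 3) (Fin n) K),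
      (∀ x : Fin 3 → K,
        (φ M27.a : Matrix (Fin 3) (Fin 3) K) *ᵥ x = ![θ * x 0, θ ^ 4 * x 1, θ ^ 7 * x 2] ∧
        (φ M27.b : Matrix (Fin 3) (Fin 3) K) *ᵥ x = ![x 1, x 2, x 0]) ∧
      (∀ (g : M27) (x : Fin n → K), M *ᵥ ((ψ g : Matrix (Fin n) (Fin n) K) *ᵥ x) =
        (φ g : Matrix (Fin 3) (Fin 3) K) *ᵥ (M *ᵥ x)) ∧ M *ᵥ v ≠ 0 := by
  have h9 : η ^ 9 = 1 := hη.pow_eq_one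
  set A : Matrix (Fin n) (Fin n) K := (ψ M27.a : Matrix (Fin n) (Fin n) K) with hAdef
  set B : Matrix (Fin n) (Fin n) K := (ψ M27.b : Matrix (Fin n) (Fin n) K) with hBdef
  have hA : A ^ 9 = 1 := by
    rw [hAdef, ← Units.val_pow_eq_pow_val, ← map_pow, M27.relations.1]; simp
  have hB : B * (B * B) = 1 := by
    rw [hBdef, ← Units.val_mul, ← Units.val_mul, ← map_mul, ← map_mul,
      show M27.b * (M27.b * M27.b) = 1 by decide]; simp
  have hBA : B * A = A ^ 4 * B := by
    rw [hAdef, hBdef, ← Units.val_pow_eq_pow_val, ← Units.val_mul, ← Units.val_mul, ← map_pow,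
      ← map_mul, ← map_mul, show M27.b * M27.a = M27.a ^ 4 * M27.b by decide]
  have hA3 : (ψ (M27.a ^ 3) : Matrix (Fin n) (Fin n) K) = A ^ 3 := by
    rw [map_pow, Units.val_pow_eq_pow_val]
  have hpow : ∀ (k m : ℕ) (q : Fin n → K), q ᵥ* A = η ^ k • q → q ᵥ* A ^ m = η ^ (k * m) • q := by
    intro k m q hq
    induction m with
    | zero => simp
    | succ m ih =>
      rw [pow_succ, ← Matrix.vecMul_vecMul, ih, Matrix.smul_vecMul, hq, smul_smul, ← pow_add]
      rfl
  obtain ⟨q, k, hq, hk, hqv⟩ : ∃ (q : Fin n → K) (k : ℕ), q ᵥ* A = η ^ k • q ∧ ¬ 3 ∣ k ∧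
      q ⬝ᵥ v ≠ 0 := by
    by_contra! hcon
    -- Eigenrows with `3 ∣ k` do not see the difference `A³v - v`. If all the others killed `v`,
    -- every functional would kill this difference and `a³` would fix `v`.
    have hall : ∀ y : Fin n → K, y ⬝ᵥ (A ^ 3 *ᵥ v - v) = 0 := by
      intro y
      have hy : y ∈ Submodule.span K {q : Fin n → K | ∃ k : ℕ, q ᵥ* A = η ^ k • q} := by
        rw [span_eigenrows_eq_top hη hA]; trivial
      induction hy using Submodule.span_induction with
      | mem q hq =>
        obtain ⟨k, hq⟩ := hq
        rw [dotProduct_sub, Matrix.dotProduct_mulVec, hpow k 3 q hq, smul_dotProduct, smul_eq_mul]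
        by_cases hk : 3 ∣ k
        · obtain ⟨l, rfl⟩ := hk
          rw [show 3 * l * 3 = 9 * l by ring, pow_mul, h9, one_pow, one_mul, sub_self]
        · rw [hcon q k hq hk, mul_zero, sub_self]
      | zero => simp
      | add x y _ _ hx hy => rw [add_dotProduct, hx, hy, add_zero]
      | smul c x _ hx => rw [smul_dotProduct, hx, smul_zero]
    rw [hA3] at hv
    apply hv
    rw [← sub_eq_zero]
    funext i
    simpa using hall (Pi.single i 1)
  have hcop : Nat.Coprime k 9 := by
    have := ((Nat.Prime.coprime_iff_not_dvd Nat.prime_three).mpr hk).symm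
    exact Nat.Coprime.pow_right 2 this
  have hθ : IsPrimitiveRoot (η ^ k) 9 := hη.pow_of_coprime k hcop
  obtain ⟨φ, hφ⟩ := exists_rep_three hθ.pow_eq_one
  -- From `B A = A⁴ B`, the rows `q, qB, qB²` are eigenrows of `A` for `θ, θ⁴, θ⁷` with `θ = η^k`,
  -- and `B` permutes them cyclically.
  let M : Matrix (Fin 3) (Fin n) K := Matrix.of ![q, q ᵥ* B, q ᵥ* (B * B)]
  have hM : ∀ x, M *ᵥ x = ![q ⬝ᵥ x, q ᵥ* B ⬝ᵥ x, q ᵥ* (B * B) ⬝ᵥ x] := fun x => by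
    funext i
    fin_cases i <;> rfl
  have hMa : ∀ x, M *ᵥ (A *ᵥ x) = (φ M27.a : Matrix (Fin 3) (Fin 3) K) *ᵥ (M *ᵥ x) := by
    intro x
    rw [(hφ _).1, hM, hM]
    simp only [Matrix.dotProduct_mulVec, Matrix.vecMul_vecMul, Matrix.cons_val]
    have e1 : q ᵥ* (B * A) = (η ^ k) ^ 4 • q ᵥ* B := by
      rw [hBA, ← Matrix.vecMul_vecMul, hpow k 4 q hq, Matrix.smul_vecMul, pow_mul]
    have hA4 : ∀ m, B * A ^ m = A ^ (4 * m) * B := by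
      intro m
      induction m with
      | zero => simp
      | succ m ih => rw [pow_succ, ← mul_assoc, ih, mul_assoc, hBA, ← mul_assoc, ← pow_add]; rfl
    have e2 : q ᵥ* (B * B * A) = (η ^ k) ^ 7 • q ᵥ* (B * B) := by
      rw [mul_assoc, hBA, ← mul_assoc, hA4, mul_assoc, ← Matrix.vecMul_vecMul,
        hpow k (4 * 4) q hq, Matrix.smul_vecMul, pow_mul,
        pow_eq_pow_mod (4 * 4) hθ.pow_eq_one]
    rw [hq, e1, e2]
    simp only [smul_dotProduct, smul_eq_mul]
  have hMb : ∀ x, M *ᵥ (B *ᵥ x) = (φ M27.b : Matrix (Fin 3) (Fin 3) K) *ᵥ (M *ᵥ x) := by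
    intro x
    rw [(hφ _).2, hM, hM]
    simp only [Matrix.dotProduct_mulVec, Matrix.vecMul_vecMul, Matrix.cons_val]
    rw [mul_assoc, hB, Matrix.vecMul_one]
  have hMpow : ∀ g : M27, (∀ x, M *ᵥ ((ψ g : Matrix (Fin n) (Fin n) K) *ᵥ x) =
      (φ g : Matrix (Fin 3) (Fin 3) K) *ᵥ (M *ᵥ x)) → ∀ (m : ℕ) (x),
      M *ᵥ ((ψ (g ^ m) : Matrix (Fin n) (Fin n) K) *ᵥ x) =
      (φ (g ^ m) : Matrix (Fin 3) (Fin 3) K) *ᵥ (M *ᵥ x) := by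
    intro g hg m
    induction m with
    | zero => simp
    | succ m ih => intro x; rw [pow_succ, mulVec_map_mul, ih, hg, mulVec_map_mul]
  refine ⟨η ^ k, hθ, φ, M, hφ, fun g x => ?_, fun h => hqv ?_⟩
  · rw [g.eq_pow_mul_pow, mulVec_map_mul, hMpow _ hMa, hMpow _ hMb, mulVec_map_mul]
  · have := congrFun h 0
    rwa [hM] at this

theorem exists_eq_mulVec_of_center_moves (hη : IsPrimitiveRoot η 9) (ψ : M27 →* GL (Fin n) K)
    {v w : Fin n → K} (hv : (ψ (M27.a ^ 3) : Matrix (Fin n) (Fin n) K) *ᵥ v ≠ v)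
    (h : ∀ f ∈ invariantsOfDegreeLE ψ 10, MvPolynomial.eval v f = MvPolynomial.eval w f) :
    ∃ g : M27, (ψ g : Matrix (Fin n) (Fin n) K) *ᵥ v = w := by
  classical
  obtain ⟨θ, hθ, φ, M, hφ, hM, hMv⟩ := exists_equivariant_three hη ψ hv
  let pull : MvPolynomial (Fin 3) K → MvPolynomial (Fin n) K :=
    MvPolynomial.aeval fun i => linForm (M i)
  have hpull : ∀ f x, MvPolynomial.eval x (pull f) = MvPolynomial.eval (M *ᵥ x) f := by
    intro f x
    simp only [pull, eval_aeval_mvPolynomial, eval_linForm]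
    rfl
  have hpulldeg : ∀ f, (pull f).totalDegree ≤ f.totalDegree := fun f =>
    totalDegree_aeval_le_of_linear _ (fun i => totalDegree_linForm_le _) f
  obtain ⟨g₀, hg₀⟩ := exists_eq_mulVec_of_eval_eq_three hθ hφ (u := M *ᵥ v) (u' := M *ᵥ w)
    fun f hf => by
      rw [← hpull, ← hpull]
      refine h _ ⟨(mem_polyInvariants_iff_eval ψ).mpr fun g x => ?_,
        (hpulldeg f).trans (hf.2.trans (by norm_num))⟩
      rw [hpull, hpull, hM]
      exact (mem_polyInvariants_iff_eval φ).mp hf.1 g _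
  by_contra! hne
  set v' := (ψ g₀ : Matrix (Fin n) (Fin n) K) *ᵥ v with hv'
  have hne' : ∀ g : M27, (ψ g : Matrix (Fin n) (Fin n) K) *ᵥ v' ≠ w := fun g => by
    rw [hv', ← mulVec_map_mul]
    exact hne _
  have hMv' : M *ᵥ v' = M *ᵥ w := by rw [hv', hM, hg₀]
  have hu : M *ᵥ w ≠ 0 := by
    rw [← hg₀]
    exact mulVec_ne_zero_of_ne_zero hMv g₀
  obtain ⟨f, hdeg, hfu, hfg⟩ := exists_vanishing_on_orbit_three hθ hφ hu
  set S := Finset.univ.filter fun g : M27 =>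
    (φ g : Matrix (Fin 3) (Fin 3) K) *ᵥ (M *ᵥ w) = M *ᵥ w with hS
  have hmemS : ∀ g, g ∈ S ↔ (φ g : Matrix (Fin 3) (Fin 3) K) *ᵥ (M *ᵥ w) = M *ᵥ w := by
    simp [hS]
  have h1S : (1 : M27) ∈ S := (hmemS 1).mpr (by simp)
  obtain ⟨y, hy⟩ := exists_dotProduct_ne_zero
    (fun g : M27 => (ψ g : Matrix (Fin n) (Fin n) K) *ᵥ v' - w) fun g => sub_ne_zero.mpr (hne' g)
  obtain ⟨p, hpdeg, hp, hpw, hpv⟩ := exists_orbit_polynomial ψ S h1S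
    (fun s hs t ht => (hmemS _).mpr (by rw [mulVec_map_mul, (hmemS t).mp ht, (hmemS s).mp hs]))
    y v' w fun g _ => by
      have := hy g
      rwa [dotProduct_sub, sub_ne_zero] at this
  -- In the transfer only the terms with `g ∈ S` survive, because `f` vanishes on the rest of the
  -- orbit of `M w`; these terms are equal by the `S`-invariance of `p`.
  have heval : ∀ x, M *ᵥ x = M *ᵥ w → MvPolynomial.eval x (polyTransfer ψ (pull f * p)) =
      S.card * (MvPolynomial.eval (M *ᵥ w) f * MvPolynomial.eval x p) := by
    intro x hx
    rw [eval_polyTransfer, ← Finset.sum_subset (Finset.subset_univ S)]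
    · rw [← nsmul_eq_mul, ← Finset.sum_const]
      refine Finset.sum_congr rfl fun g hg => ?_
      rw [map_mul, hpull, hM, hx, (hmemS g).mp hg, hp g hg]
    · intro g _ hg
      rw [map_mul, hpull, hM, hx, hfg g fun h => hg ((hmemS g).mpr h), zero_mul]
  have hinv : polyTransfer ψ (pull f * p) ∈ invariantsOfDegreeLE ψ 10 := by
    refine ⟨polyTransfer_mem ψ _, (totalDegree_polyTransfer_le ψ _).trans ?_⟩
    refine (MvPolynomial.totalDegree_mul _ _).trans (le_trans ?_ hdeg)
    exact add_le_add (hpulldeg f) (hpdeg.trans Finset.card_image_le)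
  have hfin := h _ hinv
  have hvv' := (mem_polyInvariants_iff_eval ψ).mp hinv.1 g₀ v
  rw [← hvv', ← hv', heval v' hMv', heval w rfl, hpw, mul_zero, mul_zero] at hfin
  refine mul_ne_zero (Nat.cast_ne_zero.mpr (Finset.card_ne_zero.mpr ⟨1, h1S⟩))
    (mul_ne_zero hfu hpv) hfin

/-- Summing a separating functional over `⟨a³⟩` multiplies its values on fixed vectors by 3 and
leaves it at most nine translates, so its orbit polynomial has degree at most 9. -/
theorem exists_eq_mulVec_of_center_fixes (ψ : M27 →* GL (Fin n) K)
    {v w : Fin n → K} (hv : (ψ (M27.a ^ 3) : Matrix (Fin n) (Fin n) K) *ᵥ v = v)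
    (hw : (ψ (M27.a ^ 3) : Matrix (Fin n) (Fin n) K) *ᵥ w = w)
    (h : ∀ f ∈ invariantsOfDegreeLE ψ 10, MvPolynomial.eval v f = MvPolynomial.eval w f) :
    ∃ g : M27, (ψ g : Matrix (Fin n) (Fin n) K) *ᵥ v = w := by
  classical
  by_contra! hne
  obtain ⟨y, hy⟩ := exists_dotProduct_ne_zero
    (fun g : M27 => (ψ g : Matrix (Fin n) (Fin n) K) *ᵥ v - w) fun g => sub_ne_zero.mpr (hne g)
  set C : Matrix (Fin n) (Fin n) K := (ψ (M27.a ^ 3) : Matrix (Fin n) (Fin n) K) with hC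
  have hC3 : C * C * C = 1 := by
    rw [hC, ← Units.val_mul, ← Units.val_mul, ← map_mul, ← map_mul,
      show M27.a ^ 3 * M27.a ^ 3 * M27.a ^ 3 = 1 by decide]; simp
  set y' := y + y ᵥ* C + y ᵥ* (C * C) with hy'
  have hy'C : y' ᵥ* C = y' := by
    rw [hy', Matrix.add_vecMul, Matrix.add_vecMul, Matrix.vecMul_vecMul, Matrix.vecMul_vecMul,
      hC3, Matrix.vecMul_one]
    abel
  have hy'x : ∀ x, C *ᵥ x = x → y' ⬝ᵥ x = 3 * (y ⬝ᵥ x) := by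
    intro x hx
    rw [hy', add_dotProduct, add_dotProduct, ← Matrix.dotProduct_mulVec,
      ← Matrix.dotProduct_mulVec, ← Matrix.mulVec_mulVec, hx, hx]
    ring
  obtain ⟨f, hdeg, hf, hfw, hfv⟩ := exists_orbit_polynomial ψ Finset.univ (Finset.mem_univ _)
    (fun _ _ _ _ => Finset.mem_univ _) y' v w fun g _ hg => by
      have hgv : C *ᵥ ((ψ g : Matrix (Fin n) (Fin n) K) *ᵥ v) =
          (ψ g : Matrix (Fin n) (Fin n) K) *ᵥ v := by
        rw [hC, ← mulVec_map_mul, ← M27.mul_cube_comm, mulVec_map_mul, hv]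
      rw [hy'x _ hgv, hy'x _ hw] at hg
      have := mul_left_cancel₀ (by norm_num) hg
      exact hy g (by rw [dotProduct_sub, this, sub_self])
  have hcard : (Finset.univ.image fun s : M27 =>
      y' ᵥ* (ψ s : Matrix (Fin n) (Fin n) K)).card ≤ 9 := by
    have hsub : (Finset.univ.image fun s : M27 => y' ᵥ* (ψ s : Matrix (Fin n) (Fin n) K)) ⊆
        (Finset.range 3 ×ˢ Finset.range 3).image fun ij =>
          y' ᵥ* (ψ (M27.a ^ ij.1 * M27.b ^ ij.2) : Matrix (Fin n) (Fin n) K) := by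
      intro r hr
      obtain ⟨g, -, rfl⟩ := Finset.mem_image.mp hr
      obtain ⟨i, -, j, hj, rfl⟩ := g.exists_eq_pow_mul_pow
      refine Finset.mem_image.mpr ⟨(i % 3, j), ?_, ?_⟩
      · simpa [hj] using Nat.mod_lt i (by norm_num)
      · have hCk : ∀ k : ℕ, y' ᵥ* C ^ k = y' := by
          intro k
          induction k with
          | zero => simp
          | succ k ih => rw [pow_succ, ← Matrix.vecMul_vecMul, ih, hy'C]
        have : M27.a ^ i * M27.b ^ j = (M27.a ^ 3) ^ (i / 3) * (M27.a ^ (i % 3) * M27.b ^ j) := by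
          rw [← pow_mul, ← mul_assoc, ← pow_add, Nat.div_add_mod]
        rw [this, map_mul ψ ((M27.a ^ 3) ^ (i / 3)), Units.val_mul, ← Matrix.vecMul_vecMul,
          map_pow ψ (M27.a ^ 3), Units.val_pow_eq_pow_val, hCk]
    exact (Finset.card_le_card hsub).trans (Finset.card_image_le.trans (by simp))
  have hinv : f ∈ invariantsOfDegreeLE ψ 10 :=
    ⟨(mem_polyInvariants_iff_eval ψ).mpr fun g x => hf g (Finset.mem_univ _) x, by omega⟩
  exact hfv ((h f hinv).trans hfw)

theorem isSeparatingSet_invariantsOfDegreeLE_ten (hη : IsPrimitiveRoot η 9)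
    (ψ : M27 →* GL (Fin n) K) : IsSeparatingSet ψ (invariantsOfDegreeLE ψ 10) := by
  intro v w hvw
  by_contra! h
  by_cases hv : (ψ (M27.a ^ 3) : Matrix (Fin n) (Fin n) K) *ᵥ v = v
  · by_cases hw : (ψ (M27.a ^ 3) : Matrix (Fin n) (Fin n) K) *ᵥ w = w
    · obtain ⟨g, rfl⟩ := exists_eq_mulVec_of_center_fixes ψ hv hw h
      exact hvw (vecOrbit_mulVec ψ g v).symm
    · obtain ⟨g, rfl⟩ := exists_eq_mulVec_of_center_moves hη ψ hw fun f hf => (h f hf).symm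
      exact hvw (vecOrbit_mulVec ψ g w)
  · obtain ⟨g, rfl⟩ := exists_eq_mulVec_of_center_moves hη ψ hv h
    exact hvw (vecOrbit_mulVec ψ g v).symm

end Separating

theorem mainTheorem7 (K : Type*) [Field K] [CharZero K] (hK : ∃ ω : K, orderOf ω = 9) :
    sepNoetherNumber K M27 = 10 ∧ noetherNumber K M27 = 11 := by
  obtain ⟨η, hord⟩ := hK
  have hη : IsPrimitiveRoot η 9 := hord ▸ IsPrimitiveRoot.orderOf η
  have hζ : IsPrimitiveRoot (η ^ 3) 3 := hη.pow (by norm_num) (by norm_num)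
  obtain ⟨ψ, hψ⟩ := exists_rep_four hη.pow_eq_one
  refine ⟨le_antisymm ?_ ?_, le_antisymm ?_ ?_⟩
  · exact iSup₂_le fun n φ =>
      iInf₂_le 10 ⟨by norm_num, isSeparatingSet_invariantsOfDegreeLE_ten hη φ⟩
  · exact le_iSup₂_of_le 4 ψ (le_iInf₂ fun d hd => by
      exact_mod_cast ten_le_of_isSeparatingSet hη hψ hd.2)
  · exact iSup₂_le fun n φ =>
      iInf₂_le 11 ⟨by norm_num, adjoin_invariantsOfDegreeLE_eleven φ hζ⟩
  · exact le_iSup₂_of_le 4 ψ (le_iInf₂ fun d hd => by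
      exact_mod_cast eleven_le_of_adjoin_eq hη hψ hd.2)
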